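/- Let $0<q<1$ and let $\mathcal U_q(\mathfrak{su}(3))$ be the unital associative complex algebra generated by $E_i,F_i,K_i^{\pm1}$ ($i=1,2$) with relations (where $a_{ii}=2$ and $a_{ij}=-1$ for $i\ne j$) $$K_iK_j=K_jK_i,\quad K_iK_i^{-1}=1=K_i^{-1}K_i,\quad K_iE_j=q^{a_{ij}}E_jK_i,\quad K_iF_j=q^{-a_{ij}}F_jK_i,\quad [E_i,F_j]=\delta_{ij}\frac{K_i-K_i^{-1}}{q-q^{-1}},$$ $$E_i^2E_j-(q+q^{-1})E_iE_jE_i+E_jE_i^2=0=F_i^2F_j-(q+q^{-1})F_iF_jF_i+F_jF_i^2\quad(i\neq j),$$ and with the $*$-structure (conjugate-linear, anti-multiplicative, involutive) $E_i^*=K_iF_i$, $F_i^*=E_iK_i^{-1}$, $(K_i^{\pm1})^*=K_i^{\pm1}$. Put $$\hat F_3=F_1F_2\,\frac{qK_2-q^{-1}K_2^{-1}}{q-q^{-1}}-F_2F_1\,\frac{K_2-K_2^{-1}}{q-q^{-1}}.$$ Let $\lambda_1,\lambda_2\in\mathbb N=\{0,1,2,\dots\}$ and let $V_\lambda$ be an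 irreducible finite-dimensional representation of $\mathcal U_q(\mathfrak{su}(3))$ with highest weight $\lambda=(\lambda_1,\lambda_2)$ and highest weight vector $v_\lambda$, so $E_iv_\lambda=0$ and $K_iv_\lambda=q^{\lambda_i}v_\lambda$ for $i=1,2$, equipped with an inner product such that $\langle v_\lambda,v_\lambda\rangle=1$ and $\langle Xv,w\rangle=\langle v,X^*w\rangle$ for all $X\in\mathcal U_q(\mathfrak{su}(3))$, $v,w\in V_\lambda$. Then the vectors $$F_2^k\hat F_3^lF_1^m\,v_\lambda,\qquad 0\le m\le\lambda_1,\quad 0\le l\le\lambda_2,\quad 0\le k\le\lambda_2+m-l,$$ form an orthogonal basis of $V_\lambda$. Explicitly, for $(k,l,m)$ and $(k',l',m')$ in this range, $$\langle F_2^k\hat F_3^lF_1^m\,v_\lambda,\;F_2^{k'}\hat F_3^{l'}F_1^{m'}\,v_\lambda\rangle=\delta_{k,k'}\delta_{l,l'}\delta_{m,m'}\,H_{k,l,m},$$ where $H_{k,l,m}>0$ is given by $$\begin{aligned}H_{k,l,m}={}&(q^2,q^{-2(\lambda_2-l+m)};q^2)_k\,(q^2,q^{-2\lambda_1};q^2)_m\,(q^2,q^{-2\lambda_2},q^{-2(\lambda_2+1+m)},q^{-2(\lambda_1+\lambda_2+1)};q^2)_l\\&\times(1-q^2)^{-2(k+2l+m)}(-1)^{k+l+m}q^{3(k+3l+m)}q^{-l(l-2m)}q^{2l\lambda_2},\end{aligned}$$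 with $(a;p)_n=\prod_{j=0}^{n-1}(1-ap^j)$ and $(a_1,\dots,a_r;p)_n=(a_1;p)_n\cdots(a_r;p)_n$. -/

import Mathlib

namespace UqSU3

/-- The entries `(α_i, α_j)` of the Cartan matrix of type `A₂`. -/
def cartan (i j : Fin 2) : ℤ := if i = j then 2 else -1

/-- The symbols `E_i, F_i, K_i, K_i⁻¹`, `i = 1, 2` (the index `i` of the text is `i - 1` here). -/
inductive Gen : Type
  | E (i : Fin 2)
  | F (i : Fin 2)
  | K (i : Fin 2)
  | Kinv (i : Fin 2)

/-- The free generators. -/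
abbrev fE (i : Fin 2) : FreeAlgebra ℂ Gen := FreeAlgebra.ι ℂ (Gen.E i)
abbrev fF (i : Fin 2) : FreeAlgebra ℂ Gen := FreeAlgebra.ι ℂ (Gen.F i)
abbrev fK (i : Fin 2) : FreeAlgebra ℂ Gen := FreeAlgebra.ι ℂ (Gen.K i)
abbrev fKinv (i : Fin 2) : FreeAlgebra ℂ Gen := FreeAlgebra.ι ℂ (Gen.Kinv i)

/-- The defining relations of the quantised enveloping algebra. The commutation relations that
involve `K_i⁻¹` are consequences of the listed ones. -/
inductive Rel (q : ℝ) : FreeAlgebra ℂ Gen → FreeAlgebra ℂ Gen → Prop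
  | K_comm (i j : Fin 2) : Rel q (fK i * fK j) (fK j * fK i)
  | K_Kinv (i : Fin 2) : Rel q (fK i * fKinv i) 1
  | Kinv_K (i : Fin 2) : Rel q (fKinv i * fK i) 1
  | K_E (i j : Fin 2) : Rel q (fK i * fE j) (((q : ℂ) ^ cartan i j) • (fE j * fK i))
  | K_F (i j : Fin 2) : Rel q (fK i * fF j) (((q : ℂ) ^ (-cartan i j)) • (fF j * fK i))
  | E_F_same (i : Fin 2) :
      Rel q (fE i * fF i - fF i * fE i) (((q : ℂ) - (q : ℂ)⁻¹)⁻¹ • (fK i - fKinv i))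
  | E_F_ne (i j : Fin 2) (h : i ≠ j) : Rel q (fE i * fF j - fF j * fE i) 0
  | serre_E (i j : Fin 2) (h : i ≠ j) :
      Rel q (fE i * fE i * fE j - ((q : ℂ) + (q : ℂ)⁻¹) • (fE i * fE j * fE i)
        + fE j * fE i * fE i) 0
  | serre_F (i j : Fin 2) (h : i ≠ j) :
      Rel q (fF i * fF i * fF j - ((q : ℂ) + (q : ℂ)⁻¹) • (fF i * fF j * fF i)
        + fF j * fF i * fF i) 0

end UqSU3

/-- The quantised universal enveloping algebra `U_q(su(3))`: the unital associative complex algebra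
presented by the generators and relations above. -/
def UqSU3 (q : ℝ) : Type := RingQuot (UqSU3.Rel q)

namespace UqSU3

noncomputable instance instRing (q : ℝ) : Ring (UqSU3 q) :=
  inferInstanceAs (Ring (RingQuot (Rel q)))

noncomputable instance instAlgebra (q : ℝ) : Algebra ℂ (UqSU3 q) :=
  inferInstanceAs (Algebra ℂ (RingQuot (Rel q)))

/-- The quotient map from the free algebra. -/
noncomputable def mk (q : ℝ) : FreeAlgebra ℂ Gen →ₐ[ℂ] UqSU3 q :=
  RingQuot.mkAlgHom ℂ (Rel q)

noncomputable def E (q : ℝ) (i : Fin 2) : UqSU3 q := mk q (fE i)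
noncomputable def F (q : ℝ) (i : Fin 2) : UqSU3 q := mk q (fF i)
noncomputable def K (q : ℝ) (i : Fin 2) : UqSU3 q := mk q (fK i)
noncomputable def Kinv (q : ℝ) (i : Fin 2) : UqSU3 q := mk q (fKinv i)

variable (q : ℝ)

theorem mk_surjective : Function.Surjective (mk q) := RingQuot.mkAlgHom_surjective ℂ (Rel q)

theorem mk_rel {x y : FreeAlgebra ℂ Gen} (h : Rel q x y) : mk q x = mk q y :=
  RingQuot.mkAlgHom_rel ℂ h

theorem K_comm (i j : Fin 2) : K q i * K q j = K q j * K q i := by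
  simpa [K] using mk_rel q (Rel.K_comm i j)

theorem K_Kinv (i : Fin 2) : K q i * Kinv q i = 1 := by
  simpa [K, Kinv] using mk_rel q (Rel.K_Kinv i)

theorem Kinv_K (i : Fin 2) : Kinv q i * K q i = 1 := by
  simpa [K, Kinv] using mk_rel q (Rel.Kinv_K i)

theorem K_E (i j : Fin 2) : K q i * E q j = ((q : ℂ) ^ cartan i j) • (E q j * K q i) := by
  simpa [K, E] using mk_rel q (Rel.K_E i j)

theorem K_F (i j : Fin 2) : K q i * F q j = ((q : ℂ) ^ (-cartan i j)) • (F q j * K q i) := by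
  simpa [K, F] using mk_rel q (Rel.K_F i j)

theorem E_F_same (i : Fin 2) : E q i * F q i - F q i * E q i =
    ((q : ℂ) - (q : ℂ)⁻¹)⁻¹ • (K q i - Kinv q i) := by
  simpa [K, Kinv, E, F] using mk_rel q (Rel.E_F_same i)

theorem E_F_ne (i j : Fin 2) (h : i ≠ j) : E q i * F q j - F q j * E q i = 0 := by
  simpa [E, F] using mk_rel q (Rel.E_F_ne i j h)

theorem serre_E (i j : Fin 2) (h : i ≠ j) :
    E q i * E q i * E q j - ((q : ℂ) + (q : ℂ)⁻¹) • (E q i * E q j * E q i)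
      + E q j * E q i * E q i = 0 := by
  simpa [E, mul_assoc] using mk_rel q (Rel.serre_E i j h)

theorem serre_F (i j : Fin 2) (h : i ≠ j) :
    F q i * F q i * F q j - ((q : ℂ) + (q : ℂ)⁻¹) • (F q i * F q j * F q i)
      + F q j * F q i * F q i = 0 := by
  simpa [F, mul_assoc] using mk_rel q (Rel.serre_F i j h)


theorem Kinv_comm (i j : Fin 2) : Kinv q i * Kinv q j = Kinv q j * Kinv q i := by
  calc Kinv q i * Kinv q j
      = Kinv q i * Kinv q j * (K q i * K q j) * (Kinv q j * Kinv q i) := by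
        rw [mul_assoc, mul_assoc (K q i), ← mul_assoc (K q j), K_Kinv, one_mul, K_Kinv, mul_one]
    _ = Kinv q j * Kinv q i := by
        rw [K_comm, mul_assoc (Kinv q i), ← mul_assoc (Kinv q j), Kinv_K, one_mul, Kinv_K, one_mul]

variable {q}

theorem E_eq_zero (h : q = 0) (j : Fin 2) : E q j = 0 := by
  have h1 := K_E q j j
  have h2 : K q j * E q j = 0 := by rw [h1, h]; simp [cartan]
  calc E q j = Kinv q j * (K q j * E q j) := by rw [← mul_assoc, Kinv_K, one_mul]
    _ = 0 := by rw [h2, mul_zero]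

theorem F_eq_zero (h : q = 0) (j : Fin 2) : F q j = 0 := by
  have h1 := K_F q j j
  have h2 : K q j * F q j = 0 := by rw [h1, h]; simp [cartan]
  calc F q j = Kinv q j * (K q j * F q j) := by rw [← mul_assoc, Kinv_K, one_mul]
    _ = 0 := by rw [h2, mul_zero]

theorem F_K (h : q ≠ 0) (i j : Fin 2) :
    F q i * K q j = ((q : ℂ) ^ cartan j i) • (K q j * F q i) := by
  have hq : (q : ℂ) ≠ 0 := by exact_mod_cast h
  rw [K_F, smul_smul, ← zpow_add₀ hq, add_neg_cancel, zpow_zero, one_smul]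

theorem Kinv_E (h : q ≠ 0) (i j : Fin 2) :
    Kinv q i * E q j = ((q : ℂ) ^ (-cartan i j)) • (E q j * Kinv q i) := by
  have hq : (q : ℂ) ≠ 0 := by exact_mod_cast h
  calc Kinv q i * E q j = Kinv q i * (E q j * K q i) * Kinv q i := by
        rw [mul_assoc, mul_assoc, K_Kinv, mul_one]
    _ = ((q : ℂ) ^ (-cartan i j)) • (Kinv q i * (K q i * E q j) * Kinv q i) := by
        rw [K_E, mul_smul_comm, smul_mul_assoc, smul_smul, ← zpow_add₀ hq, neg_add_cancel,
          zpow_zero, one_smul]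
    _ = _ := by rw [← mul_assoc (Kinv q i), Kinv_K, one_mul]

theorem F_Kinv (h : q ≠ 0) (i j : Fin 2) :
    F q i * Kinv q j = ((q : ℂ) ^ (-cartan j i)) • (Kinv q j * F q i) := by
  have hq : (q : ℂ) ≠ 0 := by exact_mod_cast h
  calc F q i * Kinv q j = Kinv q j * (K q j * F q i) * Kinv q j := by
        rw [← mul_assoc (Kinv q j), Kinv_K, one_mul]
    _ = ((q : ℂ) ^ (-cartan j i)) • (Kinv q j * F q i * (K q j * Kinv q j)) := by
        rw [K_F, mul_smul_comm, smul_mul_assoc]; simp only [mul_assoc]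
    _ = _ := by rw [K_Kinv, mul_one]

theorem K_Kinv_comm (i j : Fin 2) : K q i * Kinv q j = Kinv q j * K q i := by
  calc K q i * Kinv q j = Kinv q j * (K q j * K q i) * Kinv q j := by
        rw [← mul_assoc (Kinv q j), Kinv_K, one_mul]
    _ = Kinv q j * K q i := by
        rw [K_comm, mul_assoc, mul_assoc, K_Kinv, mul_one]

theorem KF_triple (h : q ≠ 0) (a b c : Fin 2) :
    K q a * F q a * (K q b * F q b * (K q c * F q c)) =
      ((q : ℂ) ^ (cartan b a + cartan c a + cartan c b)) •
        (K q a * K q b * K q c * (F q a * F q b * F q c)) := by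
  have hq : (q : ℂ) ≠ 0 := by exact_mod_cast h
  calc K q a * F q a * (K q b * F q b * (K q c * F q c))
      = K q a * (F q a * K q b) * (F q b * K q c) * F q c := by simp only [mul_assoc]
    _ = ((q : ℂ) ^ (cartan b a + cartan c b)) •
          (K q a * K q b * (F q a * K q c) * F q b * F q c) := by
        rw [F_K h, F_K h]
        simp only [mul_smul_comm, smul_mul_assoc, smul_smul, mul_assoc, ← zpow_add₀ hq]
        rw [add_comm]
    _ = _ := by
        rw [F_K h]
        simp only [mul_smul_comm, smul_mul_assoc, smul_smul, mul_assoc, ← zpow_add₀ hq]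
        congr 2; ring

theorem EKinv_triple (h : q ≠ 0) (a b c : Fin 2) :
    E q a * Kinv q a * (E q b * Kinv q b * (E q c * Kinv q c)) =
      ((q : ℂ) ^ (-(cartan a b + cartan a c + cartan b c))) •
        (E q a * E q b * E q c * (Kinv q a * Kinv q b * Kinv q c)) := by
  have hq : (q : ℂ) ≠ 0 := by exact_mod_cast h
  calc E q a * Kinv q a * (E q b * Kinv q b * (E q c * Kinv q c))
      = E q a * (Kinv q a * E q b) * (Kinv q b * E q c) * Kinv q c := by simp only [mul_assoc]
    _ = ((q : ℂ) ^ (-cartan a b + -cartan b c)) •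
          (E q a * E q b * (Kinv q a * E q c) * Kinv q b * Kinv q c) := by
        rw [Kinv_E h, Kinv_E h]
        simp only [mul_smul_comm, smul_mul_assoc, smul_smul, mul_assoc, ← zpow_add₀ hq]
        rw [add_comm]
    _ = _ := by
        rw [Kinv_E h]
        simp only [mul_smul_comm, smul_mul_assoc, smul_smul, mul_assoc, ← zpow_add₀ hq]
        congr 2; ring

variable (q)

/-- The values of the `*`-structure on the generators:
`E_i* = K_i F_i`, `F_i* = E_i K_i⁻¹`, `K_i* = K_i`, `(K_i⁻¹)* = K_i⁻¹`. -/
noncomputable def starGen : Gen → UqSU3 q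
  | Gen.E i => K q i * F q i
  | Gen.F i => E q i * Kinv q i
  | Gen.K i => K q i
  | Gen.Kinv i => Kinv q i

/-- The conjugate-linear ring homomorphism from the free algebra to the opposite of `U_q(su(3))`
with the values `starGen` on the generators. -/
noncomputable def starFree : FreeAlgebra ℂ Gen →+* (UqSU3 q)ᵐᵒᵖ :=
  letI : Algebra ℂ (UqSU3 q)ᵐᵒᵖ :=
    RingHom.toAlgebra' ((algebraMap ℂ (UqSU3 q)ᵐᵒᵖ).comp (starRingEnd ℂ))
      (fun c x => Algebra.commutes (starRingEnd ℂ c) x)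
  (FreeAlgebra.lift ℂ (fun g => MulOpposite.op (starGen q g))).toRingHom

theorem starFree_ι (g : Gen) :
    starFree q (FreeAlgebra.ι ℂ g) = MulOpposite.op (starGen q g) := by
  let _ : Algebra ℂ (UqSU3 q)ᵐᵒᵖ :=
    RingHom.toAlgebra' ((algebraMap ℂ (UqSU3 q)ᵐᵒᵖ).comp (starRingEnd ℂ))
      (fun c x => Algebra.commutes (starRingEnd ℂ c) x)
  exact FreeAlgebra.lift_ι_apply (fun g => MulOpposite.op (starGen q g)) g

theorem starFree_algebraMap (c : ℂ) :
    starFree q (algebraMap ℂ _ c) = algebraMap ℂ (UqSU3 q)ᵐᵒᵖ (starRingEnd ℂ c) := by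
  let _ : Algebra ℂ (UqSU3 q)ᵐᵒᵖ :=
    RingHom.toAlgebra' ((algebraMap ℂ (UqSU3 q)ᵐᵒᵖ).comp (starRingEnd ℂ))
      (fun c x => Algebra.commutes (starRingEnd ℂ c) x)
  exact (FreeAlgebra.lift ℂ (fun g => MulOpposite.op (starGen q g))).commutes c

theorem starFree_smul (c : ℂ) (x : FreeAlgebra ℂ Gen) :
    starFree q (c • x) = (starRingEnd ℂ c) • starFree q x := by
  rw [Algebra.smul_def, map_mul, starFree_algebraMap, ← Algebra.smul_def]

theorem starFree_rel {x y : FreeAlgebra ℂ Gen} (h : Rel q x y) : starFree q x = starFree q y := by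
  apply MulOpposite.unop_injective
  induction h with
  | K_comm i j => simpa [starFree_ι, starGen] using K_comm q j i
  | K_Kinv i => simpa [starFree_ι, starGen] using Kinv_K q i
  | Kinv_K i => simpa [starFree_ι, starGen] using K_Kinv q i
  | K_E i j =>
    simp only [starFree_ι, starFree_smul, starGen, map_mul, MulOpposite.unop_mul,
      MulOpposite.unop_smul, MulOpposite.unop_op, map_zpow₀, Complex.conj_ofReal]
    by_cases hq : q = 0
    · simp [F_eq_zero hq]
    · rw [mul_assoc, F_K hq, mul_smul_comm, ← mul_assoc, ← mul_assoc, K_comm]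
  | K_F i j =>
    simp only [starFree_ι, starFree_smul, starGen, map_mul, MulOpposite.unop_mul,
      MulOpposite.unop_smul, MulOpposite.unop_op, map_zpow₀, Complex.conj_ofReal]
    by_cases hq : q = 0
    · simp [E_eq_zero hq]
    · have hq' : (q : ℂ) ≠ 0 := by exact_mod_cast hq
      rw [← mul_assoc, K_E, smul_mul_assoc, smul_smul, ← zpow_add₀ hq', neg_add_cancel, zpow_zero,
        one_smul, mul_assoc, mul_assoc, K_Kinv_comm]
  | E_F_same i =>
    simp only [starFree_ι, starFree_smul, starGen, map_mul, map_sub, MulOpposite.unop_mul,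
      MulOpposite.unop_sub, MulOpposite.unop_smul, MulOpposite.unop_op, map_inv₀,
      Complex.conj_ofReal]
    rw [← E_F_same]
    by_cases hq : q = 0
    · simp [E_eq_zero hq]
    · have hq' : (q : ℂ) ≠ 0 := by exact_mod_cast hq
      have h1 : E q i * Kinv q i * (K q i * F q i) = E q i * F q i := by
        rw [mul_assoc, ← mul_assoc (Kinv q i), Kinv_K, one_mul]
      have h2 : K q i * F q i * (E q i * Kinv q i) = F q i * E q i := by
        rw [K_F, smul_mul_assoc, mul_assoc, ← mul_assoc (K q i), K_E, smul_mul_assoc,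
          mul_smul_comm, smul_smul, ← zpow_add₀ hq', neg_add_cancel, zpow_zero, one_smul,
          mul_assoc, K_Kinv, mul_one]
      rw [h1, h2]
  | E_F_ne i j hij =>
    simp only [starFree_ι, starGen, map_mul, map_sub, MulOpposite.unop_mul,
      MulOpposite.unop_sub, MulOpposite.unop_op, map_zero, MulOpposite.unop_zero]
    by_cases hq : q = 0
    · simp [E_eq_zero hq]
    · have hq' : (q : ℂ) ≠ 0 := by exact_mod_cast hq
      have h0 : E q j * F q i = F q i * E q j := sub_eq_zero.mp (E_F_ne q j i hij.symm)
      have h1 : E q j * Kinv q j * (K q i * F q i) =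
          ((q : ℂ) ^ (-cartan i i + cartan j i)) • (E q j * F q i * (Kinv q j * K q i)) := by
        have h3 : Kinv q j * F q i = ((q : ℂ) ^ (cartan j i)) • (F q i * Kinv q j) := by
          rw [F_Kinv hq, smul_smul, ← zpow_add₀ hq', add_neg_cancel, zpow_zero, one_smul]
        rw [K_F, mul_smul_comm, mul_assoc, ← mul_assoc (Kinv q j), h3, smul_mul_assoc,
          mul_smul_comm, smul_smul, ← zpow_add₀ hq']
        simp only [mul_assoc]
      have h2 : K q i * F q i * (E q j * Kinv q j) =
          ((q : ℂ) ^ (-cartan i i + cartan i j)) • (F q i * E q j * (Kinv q j * K q i)) := by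
        rw [K_F, smul_mul_assoc, mul_assoc, ← mul_assoc (K q i), K_E, smul_mul_assoc,
          mul_smul_comm, smul_smul, ← zpow_add₀ hq', mul_assoc (E q j), K_Kinv_comm]
        simp only [mul_assoc]
      have hc : cartan i j = cartan j i := by simp [cartan, eq_comm]
      rw [h1, h2, h0, hc, sub_self]
  | serre_E i j hij =>
    simp only [starFree_ι, starFree_smul, starGen, map_mul, map_sub, map_add, MulOpposite.unop_mul,
      MulOpposite.unop_sub, MulOpposite.unop_add, MulOpposite.unop_smul, MulOpposite.unop_op,
      map_inv₀, Complex.conj_ofReal, map_zero, MulOpposite.unop_zero]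
    by_cases hq : q = 0
    · simp [F_eq_zero hq]
    · rw [KF_triple hq, KF_triple hq, KF_triple hq]
      have e1 : K q j * K q i * K q i = K q i * K q i * K q j := by
        rw [K_comm q j i, mul_assoc, K_comm q j i, mul_assoc]
      have e2 : K q i * K q j * K q i = K q i * K q i * K q j := by
        rw [mul_assoc, K_comm q j i, mul_assoc]
      simp only [cartan, hij, hij.symm, if_true, if_false]
      norm_num
      rw [e1, e2, ← mul_smul_comm, ← mul_sub, ← mul_add]
      have := serre_F q i j hij
      rw [show F q j * F q i * F q i - ((q : ℂ) + (q : ℂ)⁻¹) • (F q i * F q j * F q i)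
        + F q i * F q i * F q j = 0 by rw [← this]; abel, mul_zero]
  | serre_F i j hij =>
    simp only [starFree_ι, starFree_smul, starGen, map_mul, map_sub, map_add, MulOpposite.unop_mul,
      MulOpposite.unop_sub, MulOpposite.unop_add, MulOpposite.unop_smul, MulOpposite.unop_op,
      map_inv₀, Complex.conj_ofReal, map_zero, MulOpposite.unop_zero]
    by_cases hq : q = 0
    · simp [E_eq_zero hq]
    · rw [EKinv_triple hq, EKinv_triple hq, EKinv_triple hq]
      have e1 : Kinv q j * Kinv q i * Kinv q i = Kinv q i * Kinv q i * Kinv q j := by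
        rw [Kinv_comm q j i, mul_assoc, Kinv_comm q j i, mul_assoc]
      have e2 : Kinv q i * Kinv q j * Kinv q i = Kinv q i * Kinv q i * Kinv q j := by
        rw [mul_assoc, Kinv_comm q j i, mul_assoc]
      simp only [cartan, hij, hij.symm, if_true, if_false]
      norm_num
      rw [e1, e2, ← smul_mul_assoc, ← sub_mul, ← add_mul]
      have := serre_E q i j hij
      rw [show E q j * E q i * E q i - ((q : ℂ) + (q : ℂ)⁻¹) • (E q i * E q j * E q i)
        + E q i * E q i * E q j = 0 by rw [← this]; abel, zero_mul]

/-- The `*`-structure as a ring homomorphism to the opposite ring. -/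
noncomputable def starHom : UqSU3 q →+* (UqSU3 q)ᵐᵒᵖ :=
  RingQuot.lift ⟨starFree q, fun _ _ h => starFree_rel q h⟩

theorem starHom_mk (x : FreeAlgebra ℂ Gen) : starHom q (mk q x) = starFree q x := by
  have : mk q x = RingQuot.mkRingHom (Rel q) x := by
    rw [mk, ← RingQuot.mkAlgHom_coe ℂ (Rel q)]; rfl
  rw [this]
  exact RingQuot.lift_mkRingHom_apply (starFree q) (fun _ _ h => starFree_rel q h) x

theorem starHom_smul (c : ℂ) (x : UqSU3 q) :
    starHom q (c • x) = (starRingEnd ℂ c) • starHom q x := by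
  obtain ⟨x, rfl⟩ := mk_surjective q x
  rw [← map_smul, starHom_mk, starHom_mk, starFree_smul]

theorem starHom_starGen (g : Gen) :
    MulOpposite.unop (starHom q (starGen q g)) = mk q (FreeAlgebra.ι ℂ g) := by
  cases g with
  | E i =>
    simp only [starGen, K, F, map_mul, starHom_mk, starFree_ι, MulOpposite.unop_mul,
      MulOpposite.unop_op]
    change E q i * Kinv q i * K q i = _
    rw [mul_assoc, Kinv_K, mul_one]; rfl
  | F i =>
    simp only [starGen, E, Kinv, map_mul, starHom_mk, starFree_ι, MulOpposite.unop_mul,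
      MulOpposite.unop_op]
    change Kinv q i * (K q i * F q i) = _
    rw [← mul_assoc, Kinv_K, one_mul]; rfl
  | K i =>
    simp only [starGen, K, starHom_mk, starFree_ι, MulOpposite.unop_op]
  | Kinv i =>
    simp only [starGen, Kinv, starHom_mk, starFree_ι, MulOpposite.unop_op]

theorem starHom_starHom (x : UqSU3 q) :
    MulOpposite.unop (starHom q (MulOpposite.unop (starHom q x))) = x := by
  obtain ⟨x, rfl⟩ := mk_surjective q x
  rw [starHom_mk]
  induction x using FreeAlgebra.induction with
  | grade0 c =>
    rw [starFree_algebraMap, Algebra.algebraMap_eq_smul_one, MulOpposite.unop_smul, starHom_smul]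
    simp [Algebra.algebraMap_eq_smul_one]
  | grade1 g => rw [starFree_ι, MulOpposite.unop_op, starHom_starGen]
  | mul a b ha hb => simp [ha, hb]
  | add a b ha hb => simp [ha, hb]

/-- `U_q(su(3))` is a `*`-algebra. -/
noncomputable instance instStarRing : StarRing (UqSU3 q) where
  star x := MulOpposite.unop (starHom q x)
  star_involutive := starHom_starHom q
  star_mul x y := by simp
  star_add x y := by simp

instance instStarModule : StarModule ℂ (UqSU3 q) where
  star_smul c x := by
    change MulOpposite.unop (starHom q (c • x)) = _
    rw [starHom_smul]; rfl

theorem star_E (i : Fin 2) : star (E q i) = K q i * F q i := by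
  change MulOpposite.unop (starHom q (mk q (fE i))) = _
  rw [starHom_mk, starFree_ι]; rfl

theorem star_F (i : Fin 2) : star (F q i) = E q i * Kinv q i := by
  change MulOpposite.unop (starHom q (mk q (fF i))) = _
  rw [starHom_mk, starFree_ι]; rfl

theorem star_K (i : Fin 2) : star (K q i) = K q i := by
  change MulOpposite.unop (starHom q (mk q (fK i))) = _
  rw [starHom_mk, starFree_ι]; rfl

theorem star_Kinv (i : Fin 2) : star (Kinv q i) = Kinv q i := by
  change MulOpposite.unop (starHom q (mk q (fKinv i))) = _
  rw [starHom_mk, starFree_ι]; rfl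

/-- `F̂₃ = F₁F₂ (q K₂ - q⁻¹ K₂⁻¹)/(q - q⁻¹) - F₂F₁ (K₂ - K₂⁻¹)/(q - q⁻¹)`. -/
noncomputable def hatF3 : UqSU3 q :=
  F q 0 * F q 1 *
      (((q : ℂ) - (q : ℂ)⁻¹)⁻¹ • ((q : ℂ) • K q 1 - ((q : ℂ)⁻¹) • Kinv q 1))
    - F q 1 * F q 0 * (((q : ℂ) - (q : ℂ)⁻¹)⁻¹ • (K q 1 - Kinv q 1))

/-- The `q`-shifted factorial `(a; p)_n = (1 - a)(1 - a p) ⋯ (1 - a p^(n-1))`. -/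
noncomputable def qPoch (a p : ℝ) (n : ℕ) : ℝ := ∏ j ∈ Finset.range n, (1 - a * p ^ j)

/-- The index set of the basis; `k ≤ λ₂ + m - l` is written without subtraction. -/
def basisIndex (l₁ l₂ : ℕ) : Set (ℕ × ℕ × ℕ) :=
  {p | p.2.2 ≤ l₁ ∧ p.2.1 ≤ l₂ ∧ p.1 + p.2.1 ≤ l₂ + p.2.2}

/-- The squared norm `H_{k,l,m}` for the highest weight `(l₁, l₂)`. -/
noncomputable def H (l₁ l₂ k l m : ℕ) : ℝ :=
  qPoch (q ^ 2) (q ^ 2) k * qPoch (q ^ (-2 * ((l₂ : ℤ) - l + m))) (q ^ 2) k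
    * (qPoch (q ^ 2) (q ^ 2) m * qPoch (q ^ (-2 * (l₁ : ℤ))) (q ^ 2) m)
    * (qPoch (q ^ 2) (q ^ 2) l * qPoch (q ^ (-2 * (l₂ : ℤ))) (q ^ 2) l
      * qPoch (q ^ (-2 * ((l₂ : ℤ) + 1 + m))) (q ^ 2) l
      * qPoch (q ^ (-2 * ((l₁ : ℤ) + l₂ + 1))) (q ^ 2) l)
    * (1 - q ^ 2) ^ (-2 * ((k : ℤ) + 2 * l + m))
    * (-1) ^ (k + l + m) * q ^ (3 * (k + 3 * l + m))
    * q ^ (-(l : ℤ) * ((l : ℤ) - 2 * m)) * q ^ (2 * (l : ℤ) * l₂)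

end UqSU3

/-! The point of `hatF3` is that it preserves the kernel of `E₂` on weight vectors and commutes
there with `F₁`. Hence every vector `u l m = F̂₃^l F₁^m v` (`lowered`) is a highest weight vector,
of weight `λ₂ + m - l`, for the copy of `U_q(sl₂)` generated by `E₂, F₂, K₂`, and the proposed basis
consists of the `F₂`-strings through the `u l m`.

Orthogonality: strings pair to zero at different heights `k` by `sl₂` theory (`inner_F_pow_of_ne`);
at equal height, distinct `(l, m)` give distinct weights.

Norms: the steps in `k` and in `m` (at `k = l = 0`) are `sl₂`-string computations. For the step in
`l` (`inner_lowered_succ`), one `F̂₃` is expanded as `[b+1] F₁F₂ - [b] F₂F₁`. The second term is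
orthogonal to the kernel of `E₂`; in the first, `F₁` is moved across the inner product, and
`E₁_smul_lowered` leaves a known multiple of the norm of `F₂ u l m`. The formula for `H` satisfies
the same recursions, with positive factors on the index set.

Spanning: outside the index range the vectors vanish, and the span is stable under all generators
(`basisSpan_eq_top`), so irreducibility makes it all of `V`. -/

namespace UqSU3

/-- The `q`-integer `[n] = (q^n - q^(-n)) / (q - q⁻¹)`. -/
noncomputable def qInt (q : ℝ) (n : ℤ) : ℝ := (q - q⁻¹)⁻¹ * (q ^ n - q ^ (-n))

/-! ### Identities between `q`-integers -/

section qInt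
variable {q : ℝ}

theorem qInt_zero : qInt q 0 = 0 := by simp [qInt]

theorem sub_inv_neg (hq0 : 0 < q) (hq1 : q < 1) : q - q⁻¹ < 0 := by
  have := one_lt_inv_iff₀.2 ⟨hq0, hq1⟩
  linarith

theorem qInt_one (hq0 : 0 < q) (hq1 : q < 1) : qInt q 1 = 1 := by
  have := (sub_inv_neg hq0 hq1).ne
  simp [qInt, this]

theorem qInt_pos (hq0 : 0 < q) (hq1 : q < 1) {n : ℤ} (hn : 0 < n) : 0 < qInt q n := by
  have h1 : q ^ n < q ^ (-n) := zpow_lt_zpow_right_of_lt_one₀ hq0 hq1 (by lia)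
  exact mul_pos_of_neg_of_neg (inv_lt_zero.2 (sub_inv_neg hq0 hq1)) (by linarith)

theorem sub_inv_ne (hq0 : 0 < q) (hq1 : q < 1) : q ^ 2 - 1 ≠ 0 := by
  have : q ^ 2 < 1 := by nlinarith
  linarith

theorem qInt_succ_mul_succ (hq0 : 0 < q) (hq1 : q < 1) (a b : ℤ) :
    qInt q (a + 1) * qInt q (b + 1) - qInt q a * qInt q b = qInt q (a + b + 1) := by
  have h := sub_inv_ne hq0 hq1
  have h0 := hq0.ne'
  have ha : q ^ a ≠ 0 := zpow_ne_zero _ h0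
  have hb : q ^ b ≠ 0 := zpow_ne_zero _ h0
  have e : q - q⁻¹ = (q ^ 2 - 1) / q := by field_simp
  simp only [qInt, zpow_neg, zpow_add₀ h0, zpow_one, e]
  field_simp
  ring

/-- The Serre relations bring in the factor `q + q⁻¹ = [2]`; this identity absorbs it into the
coefficients of `F̂₃`. -/
theorem qInt_two_mul (hq0 : 0 < q) (a : ℤ) :
    (q + q⁻¹) * qInt q a = qInt q (a + 1) + qInt q (a - 1) := by
  have h0 := hq0.ne'
  simp only [qInt, neg_add_rev, neg_sub, zpow_sub₀ h0, zpow_add₀ h0, zpow_neg, zpow_one]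
  field_simp
  ring

theorem qInt_mul_add (hq0 : 0 < q) (hq1 : q < 1) (a b : ℤ) :
    qInt q a * qInt q b + qInt q (b - 1 - a) = qInt q (a + 1) * qInt q (b - 1) := by
  have h := sub_inv_ne hq0 hq1
  have h0 := hq0.ne'
  have ha : q ^ a ≠ 0 := zpow_ne_zero _ h0
  have hb : q ^ b ≠ 0 := zpow_ne_zero _ h0
  have e : q - q⁻¹ = (q ^ 2 - 1) / q := by field_simp
  simp only [qInt, zpow_neg, zpow_add₀ h0, zpow_sub₀ h0, zpow_one, e]
  field_simp
  ring

theorem qInt_eq_one_sub (hq0 : 0 < q) (n : ℤ) :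
    qInt q n = q ^ (1 - n) * (1 - q ^ (2 * n)) / (1 - q ^ 2) := by
  have h0 := hq0.ne'
  have e : q - q⁻¹ = -((1 - q ^ 2) / q) := by field_simp; ring
  have hn : q ^ n ≠ 0 := zpow_ne_zero _ h0
  rw [qInt, e, mul_comm 2 n, zpow_mul, zpow_sub₀ h0, zpow_neg, zpow_one, inv_neg, inv_div,
    zpow_ofNat]
  have : q * (q ^ n)⁻¹ * (1 - (q ^ n) ^ 2) = q * ((q ^ n)⁻¹ - q ^ n) := by
    field_simp
  rw [div_eq_mul_inv q (q ^ n), this]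
  ring

theorem qInt_eq_neg_one_sub (hq0 : 0 < q) (n : ℤ) :
    qInt q n = -(q ^ (1 + n) * (1 - q ^ (-2 * n)) / (1 - q ^ 2)) := by
  have h := qInt_eq_one_sub hq0 (-n)
  rw [show qInt q (-n) = -qInt q n by simp only [qInt, neg_neg]; ring] at h
  rw [← neg_eq_iff_eq_neg, h]
  congr 4
  · ring
  · ring_nf

theorem qPoch_succ (a p : ℝ) (n : ℕ) : qPoch a p (n + 1) = qPoch a p n * (1 - a * p ^ n) :=
  Finset.prod_range_succ _ _

theorem zpow_mul_sq_pow (hq0 : 0 < q) (a b : ℤ) (j : ℕ) (h : a + 2 * j = b) :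
    q ^ a * (q ^ 2) ^ j = q ^ b := by
  rw [← h, zpow_add₀ hq0.ne', zpow_mul, zpow_natCast, zpow_ofNat]

theorem sq_mul_sq_pow (hq0 : 0 < q) (j : ℕ) : q ^ 2 * (q ^ 2) ^ j = q ^ (2 * ((j : ℤ) + 1)) := by
  rw [← zpow_mul_sq_pow hq0 2 _ j (by ring)]
  norm_cast

/-- The ratio of the squared norms of successive vectors in an `sl₂`-string. -/
theorem qInt_string_step (hq0 : 0 < q) (hq1 : q < 1) (n : ℤ) (k : ℕ) :
    q ^ (2 + 2 * k - n) * qInt q (k + 1) * qInt q (n - k) =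
      (1 - q ^ 2 * (q ^ 2) ^ k) * (1 - q ^ (-2 * n) * (q ^ 2) ^ k) * (1 - q ^ 2) ^ (-2 : ℤ)
        * (-1) * q ^ 3 := by
  have h0 := hq0.ne'
  have h := sub_inv_ne hq0 hq1
  have h' : 1 - q ^ 2 ≠ 0 := fun h2 => h (by linarith)
  rw [sq_mul_sq_pow hq0, zpow_mul_sq_pow hq0 (-2 * n) (-2 * (n - k)) k (by ring),
    qInt_eq_one_sub hq0 (k + 1), qInt_eq_neg_one_sub hq0 (n - k)]
  have e : q ^ (2 + 2 * k - n) * q ^ (1 - ((k : ℤ) + 1)) * q ^ (1 + (n - k)) = q ^ 3 := by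
    rw [← zpow_add₀ h0, ← zpow_add₀ h0, ← zpow_natCast]
    congr 1; push_cast; ring
  rw [← e, zpow_neg, zpow_ofNat]
  field_simp

/-! ### Recursions for the squared norm `H` and its positivity -/

theorem H_zero (l₁ l₂ : ℕ) : H q l₁ l₂ 0 0 0 = 1 := by simp [H, qPoch]

theorem H_succ_left (hq0 : 0 < q) (hq1 : q < 1) (l₁ l₂ k l m : ℕ) :
    H q l₁ l₂ (k + 1) l m =
      q ^ (2 + 2 * k - ((l₂ : ℤ) - l + m)) * qInt q (k + 1) * qInt q ((l₂ : ℤ) - l + m - k)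
        * H q l₁ l₂ k l m := by
  have h : 1 - q ^ 2 ≠ 0 := fun h2 => sub_inv_ne hq0 hq1 (by linarith)
  rw [qInt_string_step hq0 hq1, H, H, qPoch_succ, qPoch_succ]
  rw [show -2 * (((k + 1 : ℕ) : ℤ) + 2 * l + m) = -2 * (k + 2 * l + m) + -2 by push_cast; ring,
    zpow_add₀ h, show k + 1 + l + m = k + l + m + 1 by ring, pow_succ (-1 : ℝ),
    show 3 * (k + 1 + 3 * l + m) = 3 * (k + 3 * l + m) + 3 by ring, pow_add q]
  ring

theorem H_succ_right (hq0 : 0 < q) (hq1 : q < 1) (l₁ l₂ m : ℕ) :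
    H q l₁ l₂ 0 0 (m + 1) =
      q ^ (2 + 2 * m - (l₁ : ℤ)) * qInt q (m + 1) * qInt q ((l₁ : ℤ) - m) * H q l₁ l₂ 0 0 m := by
  have h : 1 - q ^ 2 ≠ 0 := fun h2 => sub_inv_ne hq0 hq1 (by linarith)
  rw [qInt_string_step hq0 hq1, H, H, qPoch_succ, qPoch_succ]
  rw [show 3 * (0 + 3 * 0 + (m + 1)) = 3 * (0 + 3 * 0 + m) + 3 by ring, pow_add q,
    show -2 * (((0 : ℕ) : ℤ) + 2 * (0 : ℕ) + (m + 1 : ℕ)) = -2 * ((0 : ℕ) + 2 * (0 : ℕ) + m) + -2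
      by push_cast; ring, zpow_add₀ h, show 0 + 0 + (m + 1) = 0 + 0 + m + 1 by ring,
    pow_succ (-1 : ℝ)]
  simp [qPoch]
  ring

theorem H_succ_mid (hq0 : 0 < q) (hq1 : q < 1) (l₁ l₂ l m : ℕ) :
    H q l₁ l₂ 0 (l + 1) m =
      q ^ (3 + 2 * (l : ℤ) + m - l₁ - l₂) * qInt q (l + 1) * qInt q ((l₂ : ℤ) - l)
        * qInt q ((l₂ : ℤ) + 1 + m - l) * qInt q ((l₁ : ℤ) + l₂ + 1 - l) * H q l₁ l₂ 0 l m := by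
  have h0 := hq0.ne'
  have h : 1 - q ^ 2 ≠ 0 := fun h2 => sub_inv_ne hq0 hq1 (by linarith)
  have key : q ^ (3 + 2 * (l : ℤ) + m - l₁ - l₂) * qInt q (l + 1) * qInt q ((l₂ : ℤ) - l)
        * qInt q ((l₂ : ℤ) + 1 + m - l) * qInt q ((l₁ : ℤ) + l₂ + 1 - l) =
      (1 - q ^ 2 * (q ^ 2) ^ l) * (1 - q ^ (-2 * (l₂ : ℤ)) * (q ^ 2) ^ l)
        * (1 - q ^ (-2 * ((l₂ : ℤ) + 1 + m)) * (q ^ 2) ^ l)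
        * (1 - q ^ (-2 * ((l₁ : ℤ) + l₂ + 1)) * (q ^ 2) ^ l)
        * (1 - q ^ 2) ^ (-4 : ℤ) * (-1) * q ^ (8 + 2 * m - 2 * l + 2 * (l₂ : ℤ)) := by
    rw [sq_mul_sq_pow hq0,
      zpow_mul_sq_pow hq0 (-2 * (l₂ : ℤ)) (-2 * ((l₂ : ℤ) - l)) l (by ring),
      zpow_mul_sq_pow hq0 _ (-2 * ((l₂ : ℤ) + 1 + m - l)) l (by ring),
      zpow_mul_sq_pow hq0 _ (-2 * ((l₁ : ℤ) + l₂ + 1 - l)) l (by ring),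
      qInt_eq_one_sub hq0 (l + 1), qInt_eq_neg_one_sub hq0 (l₂ - l),
      qInt_eq_neg_one_sub hq0 (l₂ + 1 + m - l), qInt_eq_neg_one_sub hq0 (l₁ + l₂ + 1 - l)]
    have e : q ^ (8 + 2 * m - 2 * l + 2 * (l₂ : ℤ)) = q ^ (3 + 2 * (l : ℤ) + m - l₁ - l₂)
        * q ^ (1 - ((l : ℤ) + 1)) * q ^ (1 + ((l₂ : ℤ) - l)) * q ^ (1 + ((l₂ : ℤ) + 1 + m - l))
        * q ^ (1 + ((l₁ : ℤ) + l₂ + 1 - l)) := by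
      simp only [← zpow_add₀ h0]
      congr 1; ring
    rw [e, zpow_neg, zpow_ofNat]
    field_simp
  rw [key, H, H]
  simp only [qPoch_succ]
  -- The three powers are the increments of `q^(3(k+3l+m))`, `q^(-l(l-2m))` and `q^(2lλ₂)` under `l
  -- ↦ l + 1`.
  have e : q ^ (8 + 2 * m - 2 * l + 2 * (l₂ : ℤ)) = q ^ 9 * q ^ (-1 - 2 * (l : ℤ) + 2 * m)
      * q ^ (2 * (l₂ : ℤ)) := by
    rw [← zpow_natCast, ← zpow_add₀ h0, ← zpow_add₀ h0]
    congr 1; push_cast; ring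
  rw [e, show -2 * (((0 : ℕ) : ℤ) + 2 * (l + 1 : ℕ) + m) = -2 * ((0 : ℕ) + 2 * l + m) + -4
      by push_cast; ring, zpow_add₀ h, show 0 + (l + 1) + m = 0 + l + m + 1 by ring,
    pow_succ (-1 : ℝ), show 3 * (0 + 3 * (l + 1) + m) = 3 * (0 + 3 * l + m) + 9 by ring, pow_add q,
    show -((l + 1 : ℕ) : ℤ) * (((l + 1 : ℕ) : ℤ) - 2 * m) =
      -(l : ℤ) * (l - 2 * m) + (-1 - 2 * (l : ℤ) + 2 * m) by push_cast; ring, zpow_add₀ h0,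
    show 2 * ((l + 1 : ℕ) : ℤ) * l₂ = 2 * l * l₂ + 2 * l₂ by push_cast; ring,
    zpow_add₀ h0 (2 * (l : ℤ) * l₂)]
  simp [qPoch]
  ring

/-- The signs hidden in the shifted factorials disappear in the recursions: the index inequalities
make every `q`-integer there positive. -/
theorem H_pos (hq0 : 0 < q) (hq1 : q < 1) {l₁ l₂ k l m : ℕ}
    (h : (k, l, m) ∈ basisIndex l₁ l₂) : 0 < H q l₁ l₂ k l m := by
  obtain ⟨hm, hl, hk⟩ := h
  dsimp only at hm hl hk
  have hz : ∀ n : ℤ, 0 < q ^ n := fun n => zpow_pos hq0 n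
  have pos : ∀ {n : ℤ}, 0 < n → 0 < qInt q n := qInt_pos hq0 hq1
  induction k with
  | succ k ih =>
    rw [H_succ_left hq0 hq1]
    exact mul_pos (mul_pos (mul_pos (hz _) (pos (by lia))) (pos (by lia))) (ih (by lia))
  | zero =>
    induction l with
    | succ l ih =>
      rw [H_succ_mid hq0 hq1]
      exact mul_pos (mul_pos (mul_pos (mul_pos (mul_pos (hz _) (pos (by lia))) (pos (by lia)))
        (pos (by lia))) (pos (by lia))) (ih (by lia) (by lia))
    | zero =>
      induction m with
      | zero => rw [H_zero]; exact one_pos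
      | succ m ih =>
        rw [H_succ_right hq0 hq1]
        exact mul_pos (mul_pos (mul_pos (hz _) (pos (by lia))) (pos (by lia)))
          (ih (by lia) (by lia))

end qInt

/-! ### Action on weight vectors and commutation rules for `F̂₃` -/

section Module
variable {q : ℝ} {V : Type*} [AddCommGroup V] [Module ℂ V] [Module (UqSU3 q) V]
  [IsScalarTower ℂ (UqSU3 q) V]

theorem smul_smul_comm (X : UqSU3 q) (c : ℂ) (x : V) : X • c • x = c • X • x := smul_comm X c x

theorem coe_qInt (n : ℤ) :
    ((qInt q n : ℝ) : ℂ) = ((q : ℂ) - (q : ℂ)⁻¹)⁻¹ * ((q : ℂ) ^ n - (q : ℂ) ^ (-n)) := by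
  simp [qInt]

theorem Kinv_smul_of_K_smul (hq : q ≠ 0) {i : Fin 2} {x : V} {a : ℤ}
    (h : K q i • x = ((q : ℂ) ^ a) • x) : Kinv q i • x = ((q : ℂ) ^ (-a)) • x := by
  have hq' : (q : ℂ) ≠ 0 := by exact_mod_cast hq
  have h1 : Kinv q i • K q i • x = x := by rw [smul_smul, Kinv_K, one_smul]
  rw [h, smul_comm] at h1
  calc Kinv q i • x = ((q : ℂ) ^ (-a)) • ((q : ℂ) ^ a) • Kinv q i • x := by
        rw [smul_smul, ← zpow_add₀ hq', neg_add_cancel, zpow_zero, one_smul]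
    _ = _ := by rw [h1]

theorem K_smul_F (hq : q ≠ 0) {i : Fin 2} (j : Fin 2) {x : V} {a : ℤ}
    (h : K q i • x = ((q : ℂ) ^ a) • x) :
    K q i • F q j • x = ((q : ℂ) ^ (a - cartan i j)) • F q j • x := by
  have hq' : (q : ℂ) ≠ 0 := by exact_mod_cast hq
  rw [smul_smul, K_F, smul_assoc, mul_smul, h, smul_smul_comm (F q j), smul_smul, ← zpow_add₀ hq']
  ring_nf

theorem K_smul_F_pow (hq : q ≠ 0) {i : Fin 2} (j : Fin 2) {x : V} {a : ℤ}
    (h : K q i • x = ((q : ℂ) ^ a) • x) (k : ℕ) :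
    K q i • F q j ^ k • x = ((q : ℂ) ^ (a - k * cartan i j)) • F q j ^ k • x := by
  induction k with
  | zero => simpa using h
  | succ k ih =>
    rw [pow_succ', mul_smul, K_smul_F hq j ih]
    congr 2; push_cast; ring

theorem E_smul_F_same (hq : q ≠ 0) {i : Fin 2} {x : V} {a : ℤ}
    (h : K q i • x = ((q : ℂ) ^ a) • x) :
    E q i • F q i • x = F q i • E q i • x + (qInt q a : ℂ) • x := by
  have h1 := congrArg (· • x) (E_F_same q i)
  simp only [sub_smul, mul_smul, smul_assoc, h, Kinv_smul_of_K_smul hq h] at h1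
  rw [← sub_eq_iff_eq_add', h1, coe_qInt, mul_smul, sub_smul]

theorem E_smul_F_ne {V : Type*} [AddCommGroup V] [Module (UqSU3 q) V] {i j : Fin 2} (h : i ≠ j) (x : V) :
    E q i • F q j • x = F q j • E q i • x := by
  rw [smul_smul, smul_smul, sub_eq_zero.1 (E_F_ne q i j h)]

/-- The action of `E` on the `F`-string through a vector killed by `E`. -/
theorem E_smul_F_pow (hq0 : 0 < q) (hq1 : q < 1) {i : Fin 2} {x : V} {n : ℤ}
    (hK : K q i • x = ((q : ℂ) ^ n) • x) (hE : E q i • x = 0) (k : ℕ) :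
    E q i • F q i ^ (k + 1) • x = ((qInt q (k + 1) * qInt q (n - k) : ℝ) : ℂ) • F q i ^ k • x := by
  induction k with
  | zero => simp [E_smul_F_same hq0.ne' hK, hE, qInt_one hq0 hq1]
  | succ k ih =>
    rw [pow_succ', mul_smul, E_smul_F_same hq0.ne' (K_smul_F_pow hq0.ne' i hK (k + 1)), ih,
      smul_smul_comm (F q i), ← mul_smul, ← pow_succ', ← add_smul]
    congr 1
    norm_cast
    have := qInt_mul_add hq0 hq1 (k + 1) (n - k)
    simp only [cartan, if_true]
    push_cast
    rw [show n - ((k : ℤ) + 1) * 2 = n - k - 1 - (k + 1) by ring, this, ← sub_sub]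

theorem serre_F_smul {i j : Fin 2} (h : i ≠ j) (x : V) :
    F q i • F q i • F q j • x = ((q : ℂ) + (q : ℂ)⁻¹) • F q i • F q j • F q i • x
      - F q j • F q i • F q i • x := by
  have h1 := congrArg (· • x) (serre_F q i j h)
  simp only [add_smul, sub_smul, mul_smul, smul_assoc, zero_smul] at h1
  generalize F q i • F q i • F q j • x = y₁, F q i • F q j • F q i • x = y₂,
    F q j • F q i • F q i • x = y₃ at *
  linear_combination (norm := module) h1

/-- A joint eigenvector of `K₁` and `K₂` with eigenvalues `q^a` and `q^b`. -/
structure IsWeight (q : ℝ) {V : Type*} [AddCommGroup V] [Module ℂ V] [Module (UqSU3 q) V]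
    (x : V) (a b : ℤ) : Prop where
  K₁ : K q 0 • x = ((q : ℂ) ^ a) • x
  K₂ : K q 1 • x = ((q : ℂ) ^ b) • x

namespace IsWeight
variable {x : V} {a b : ℤ}

theorem F₁ (h : IsWeight q x a b) (hq : q ≠ 0) : IsWeight q (F q 0 • x) (a - 2) (b + 1) :=
  ⟨by simpa [cartan] using K_smul_F hq 0 h.K₁, by simpa [cartan] using K_smul_F hq 0 h.K₂⟩

theorem F₂ (h : IsWeight q x a b) (hq : q ≠ 0) : IsWeight q (F q 1 • x) (a + 1) (b - 2) :=
  ⟨by simpa [cartan] using K_smul_F hq 1 h.K₁, by simpa [cartan] using K_smul_F hq 1 h.K₂⟩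

/-- On a weight vector the Cartan factors of `F̂₃` are scalars, so all later work is with `F₁F₂` and
`F₂F₁` and coefficients depending on the weight. -/
theorem hatF3_smul (h : IsWeight q x a b) (hq : q ≠ 0) :
    hatF3 q • x = (qInt q (b + 1) : ℂ) • F q 0 • F q 1 • x
      - (qInt q b : ℂ) • F q 1 • F q 0 • x := by
  have hq' : (q : ℂ) ≠ 0 := by exact_mod_cast hq
  have h2 := Kinv_smul_of_K_smul hq h.K₂
  have e1 : (((q : ℂ) - (q : ℂ)⁻¹)⁻¹ • ((q : ℂ) • K q 1 - ((q : ℂ)⁻¹) • Kinv q 1)) • x =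
      (qInt q (b + 1) : ℂ) • x := by
    rw [smul_assoc, sub_smul, smul_assoc, smul_assoc, h.K₂, h2, coe_qInt, neg_add,
      zpow_add₀ hq', zpow_add₀ hq', zpow_one, zpow_neg_one]
    module
  have e2 : (((q : ℂ) - (q : ℂ)⁻¹)⁻¹ • (K q 1 - Kinv q 1)) • x = (qInt q b : ℂ) • x := by
    rw [smul_assoc, sub_smul, h.K₂, h2, coe_qInt]
    module
  rw [hatF3, sub_smul, mul_smul _ _ x, mul_smul _ _ x, e1, e2, smul_smul_comm _ _ x,
    smul_smul_comm _ _ x, mul_smul, mul_smul]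

theorem hatF3 (h : IsWeight q x a b) (hq : q ≠ 0) :
    IsWeight q (hatF3 q • x) (a - 1) (b - 1) := by
  have h1 := (h.F₂ hq).F₁ hq
  have h2 := (h.F₁ hq).F₂ hq
  rw [h.hatF3_smul hq]
  constructor
  · rw [smul_sub, smul_smul_comm (K q 0), smul_smul_comm (K q 0), h1.K₁, h2.K₁, smul_sub,
      show a + 1 - 2 = a - 1 by ring, show a - 2 + 1 = a - 1 by ring]
    simp only [smul_comm ((q : ℂ) ^ (a - 1))]
  · rw [smul_sub, smul_smul_comm (K q 1), smul_smul_comm (K q 1), h1.K₂, h2.K₂, smul_sub,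
      show b + 1 - 2 = b - 1 by ring, show b - 2 + 1 = b - 1 by ring]
    simp only [smul_comm ((q : ℂ) ^ (b - 1))]

/-- `F₁` raises the `K₂`-weight by one and so shifts the coefficients of `F̂₃`; the Serre relation
together with `[2][b+1] = [b+2] + [b]` compensates exactly for this shift. -/
theorem F₁_hatF3_comm (h : IsWeight q x a b) (hq0 : 0 < q) :
    F q 0 • UqSU3.hatF3 q • x = UqSU3.hatF3 q • F q 0 • x := by
  have hs := serre_F_smul (q := q) (i := 0) (j := 1) (by decide) x
  have e : ((q : ℂ) + (q : ℂ)⁻¹) * (qInt q (b + 1) : ℂ) = qInt q (b + 1 + 1) + qInt q b := by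
    have := qInt_two_mul hq0 (b + 1)
    rw [add_sub_cancel_right] at this
    exact_mod_cast this
  rw [h.hatF3_smul hq0.ne', (h.F₁ hq0.ne').hatF3_smul hq0.ne', smul_sub, smul_smul_comm (F q 0),
    smul_smul_comm (F q 0), hs]
  generalize F q 0 • F q 1 • F q 0 • x = y₁, F q 1 • F q 0 • F q 0 • x = y₂
  linear_combination (norm := module) e • y₁

/-- `E₂` sends `F₁F₂x` to `[b] F₁x` and `F₂F₁x` to `[b+1] F₁x`; the coefficients of `F̂₃` are chosen
so that these cancel. -/
theorem E₂_hatF3 (h : IsWeight q x a b) (hq : q ≠ 0) (hE : E q 1 • x = 0) :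
    E q 1 • UqSU3.hatF3 q • x = 0 := by
  rw [h.hatF3_smul hq, smul_sub, smul_smul_comm (E q 1), smul_smul_comm (E q 1),
    E_smul_F_ne (j := 0) (by decide), E_smul_F_same hq h.K₂, E_smul_F_same hq (h.F₁ hq).K₂,
    E_smul_F_ne (j := 0) (by decide), hE]
  simp only [smul_zero, zero_add]
  rw [smul_smul_comm (F q 0), smul_comm, sub_self]

theorem E₁_hatF3 (h : IsWeight q x a b) (hq0 : 0 < q) (hq1 : q < 1) :
    E q 0 • UqSU3.hatF3 q • x = (qInt q (a + b + 1) : ℂ) • F q 1 • x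
      + ((qInt q (b + 1) : ℂ) • F q 0 • F q 1 • E q 0 • x
        - (qInt q b : ℂ) • F q 1 • F q 0 • E q 0 • x) := by
  have hq := hq0.ne'
  have e : (qInt q (a + 1) : ℂ) * qInt q (b + 1) - qInt q a * qInt q b = qInt q (a + b + 1) := by
    exact_mod_cast qInt_succ_mul_succ hq0 hq1 a b
  rw [h.hatF3_smul hq, smul_sub, smul_smul_comm (E q 0), smul_smul_comm (E q 0),
    E_smul_F_same hq (h.F₂ hq).K₁, E_smul_F_ne (i := 0) (j := 1) (by decide),
    E_smul_F_ne (i := 0) (j := 1) (by decide), E_smul_F_same hq h.K₁, smul_add (F q 1),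
    smul_smul_comm (F q 1), ← e]
  generalize F q 0 • F q 1 • E q 0 • x = y₁, F q 1 • F q 0 • E q 0 • x = y₂, F q 1 • x = y₃
  module

end IsWeight

/-- The vectors `F̂₃^l F₁^m v`. -/
noncomputable def lowered (q : ℝ) {V : Type*} [AddCommGroup V] [Module (UqSU3 q) V]
    (v : V) (l m : ℕ) : V := hatF3 q ^ l • F q 0 ^ m • v

/-! ### Action of the generators on `F̂₃^l F₁^m v` -/

section lowered
variable {v : V} {a b : ℤ}

theorem hatF3_smul_lowered {V : Type*} [AddCommGroup V] [Module (UqSU3 q) V] (v : V) (l m : ℕ) :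
    hatF3 q • lowered q v l m = lowered q v (l + 1) m := by
  rw [lowered, lowered, pow_succ' _ l, mul_smul]

theorem isWeight_lowered (hq : q ≠ 0) (h : IsWeight q v a b) (l m : ℕ) :
    IsWeight q (lowered q v l m) (a - 2 * m - l) (b + m - l) := by
  induction l with
  | zero =>
    induction m with
    | zero => simpa [lowered] using h
    | succ m ih =>
      rw [lowered, pow_zero, one_smul] at ih ⊢
      rw [pow_succ', mul_smul]
      convert ih.F₁ hq using 1 <;> push_cast <;> ring
  | succ l ih =>
    rw [← hatF3_smul_lowered]
    convert ih.hatF3 hq using 1 <;> push_cast <;> ring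

theorem F₁_smul_lowered (hq0 : 0 < q) (h : IsWeight q v a b) (l m : ℕ) :
    F q 0 • lowered q v l m = lowered q v l (m + 1) := by
  induction l with
  | zero => simp [lowered, pow_succ' _ m, mul_smul]
  | succ l ih =>
    rw [← hatF3_smul_lowered, (isWeight_lowered hq0.ne' h l m).F₁_hatF3_comm hq0, ih,
      hatF3_smul_lowered]

theorem E₂_smul_lowered (hq : q ≠ 0) (h : IsWeight q v a b) (hE : E q 1 • v = 0) (l m : ℕ) :
    E q 1 • lowered q v l m = 0 := by
  induction l with
  | zero =>
    rw [lowered, pow_zero, one_smul]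
    induction m with
    | zero => simpa using hE
    | succ m ih => rw [pow_succ', mul_smul, E_smul_F_ne (by decide), ih, smul_zero]
  | succ l ih =>
    rw [← hatF3_smul_lowered]
    exact (isWeight_lowered hq h l m).E₂_hatF3 hq ih

theorem lowered_succ_left (hq : q ≠ 0) (h : IsWeight q v a b) (l m : ℕ) :
    lowered q v (l + 1) m = (qInt q (b + m - l + 1) : ℂ) • F q 0 • F q 1 • lowered q v l m
      - (qInt q (b + m - l) : ℂ) • F q 1 • F q 0 • lowered q v l m := by
  rw [← hatF3_smul_lowered, (isWeight_lowered hq h l m).hatF3_smul hq]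

/-- Induction on `l` through `E₁_hatF3`: each step contributes a new multiple of `F₂ u l 0`, and the
old term is brought to the same form by the Serre relation. -/
theorem E₁_smul_lowered_zero (hq0 : 0 < q) (hq1 : q < 1) (h : IsWeight q v a b)
    (hE : E q 0 • v = 0) (l : ℕ) :
    E q 0 • lowered q v (l + 1) 0 =
      ((qInt q (l + 1) * qInt q (a + b + 1 - l) : ℝ) : ℂ) • F q 1 • lowered q v l 0 := by
  have hw := isWeight_lowered hq0.ne' h
  induction l with
  | zero =>
    rw [← hatF3_smul_lowered, (hw 0 0).E₁_hatF3 hq0 hq1]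
    simp [lowered, hE, qInt_one hq0 hq1]
  | succ l ih =>
    rw [← hatF3_smul_lowered, (hw (l + 1) 0).E₁_hatF3 hq0 hq1, ih, lowered_succ_left hq0.ne' h]
    have hs := serre_F_smul (q := q) (i := 1) (j := 0) (by decide) (lowered q v l 0)
    have e1 : (qInt q (l + 1) : ℂ) * qInt q (a + b + 1 - l) + qInt q (a + b - 1 - 2 * l) =
        qInt q (l + 1 + 1) * qInt q (a + b - l) := by
      have := qInt_mul_add hq0 hq1 (l + 1) (a + b + 1 - l)
      rw [show a + b + 1 - (l : ℤ) - 1 - (l + 1) = a + b - 1 - 2 * l by ring,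
        show a + b + 1 - (l : ℤ) - 1 = a + b - l by ring] at this
      exact_mod_cast this
    have e2 : ((q : ℂ) + (q : ℂ)⁻¹) * (qInt q (b - l) : ℂ) =
        qInt q (b - l + 1) + qInt q (b - l - 1) := by
      exact_mod_cast qInt_two_mul hq0 (b - l)
    have i1 : a - 2 * ((0 : ℕ) : ℤ) - (l + 1 : ℕ) + (b + (0 : ℕ) - (l + 1 : ℕ)) + 1 =
      a + b - 1 - 2 * l := by push_cast; ring
    have i2 : b + ((0 : ℕ) : ℤ) - (l + 1 : ℕ) = b - l - 1 := by push_cast; ring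
    have i3 : a + b + 1 - ((l + 1 : ℕ) : ℤ) = a + b - l := by push_cast; ring
    have i4 : b + ((0 : ℕ) : ℤ) - l = b - l := by push_cast; ring
    have i5 : (((l + 1 : ℕ) : ℤ) + 1) = l + 1 + 1 := by push_cast; ring
    rw [i1, i2, i3, i4, i5, sub_add_cancel]
    set u := lowered q v l 0
    set D : ℂ := ((qInt q (l + 1) * qInt q (a + b + 1 - l) : ℝ) : ℂ) with hD
    push_cast at hD ⊢
    simp only [smul_sub, smul_smul_comm (F q 1), smul_smul_comm (F q 0)]
    rw [← hD] at e1
    -- The left side is not `F̂₃F₂u`: its coefficients belong to the weight of `F̂₃u`, since `E₁`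
    -- has already been moved to the right. With these coefficients the Serre relation turns it into
    -- `F₂F̂₃u`.
    have key : (qInt q (b - l) : ℂ) • F q 0 • F q 1 • F q 1 • u
        - (qInt q (b - l - 1) : ℂ) • F q 1 • F q 0 • F q 1 • u =
        (qInt q (b - l + 1) : ℂ) • F q 1 • F q 0 • F q 1 • u
        - (qInt q (b - l) : ℂ) • F q 1 • F q 1 • F q 0 • u := by
      rw [eq_sub_iff_add_eq'] at hs
      generalize F q 1 • F q 0 • F q 1 • u = y₁, F q 1 • F q 1 • F q 0 • u = y₂,
        F q 0 • F q 1 • F q 1 • u = y₃ at *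
      linear_combination (norm := module) (qInt q (b - l) : ℂ) • hs + e2 • y₁
    generalize F q 1 • F q 0 • F q 1 • u = y₁, F q 1 • F q 1 • F q 0 • u = y₂,
      F q 0 • F q 1 • F q 1 • u = y₃ at *
    linear_combination (norm := module) D • key
      + e1 • ((qInt q (b - l + 1) : ℂ) • y₁ - (qInt q (b - l) : ℂ) • y₂)

/-- The expansion of `F̂₃` solved for `F₁F₂`; the bound on the weight keeps the divisor `[b+m-l+1]`
nonzero. -/
theorem F₁_F₂_smul_lowered (hq0 : 0 < q) (hq1 : q < 1) (h : IsWeight q v a b) {l m : ℕ}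
    (hb : 0 ≤ b + m - l) :
    F q 0 • F q 1 • lowered q v l m = ((qInt q (b + m - l + 1) : ℂ))⁻¹ • lowered q v (l + 1) m
      + ((qInt q (b + m - l) / qInt q (b + m - l + 1) : ℝ) : ℂ) • F q 1 • lowered q v l (m + 1) := by
  have hne : (qInt q (b + m - l + 1) : ℂ) ≠ 0 := by
    exact_mod_cast (qInt_pos hq0 hq1 (by lia)).ne'
  rw [lowered_succ_left hq0.ne' h, F₁_smul_lowered hq0 h, smul_sub, smul_smul, smul_smul,
    inv_mul_cancel₀ hne, one_smul]
  push_cast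
  rw [div_eq_inv_mul, mul_smul (_ : ℂ) (_ : ℂ), sub_add_cancel]

/-- Induction on `m`, writing `u (l+1) (m+1)` as `F₁ u (l+1) m`. The ratios `[b+m-l]/[b+m-l+1]` from
`F₁F₂` telescope to `[b-l]/[b+m-l]`. The value of `c` is irrelevant: its term is orthogonal to the
image of `F₂`. -/
theorem E₁_smul_lowered (hq0 : 0 < q) (hq1 : q < 1) (h : IsWeight q v a b)
    (hE : E q 0 • v = 0) {l : ℕ} (hl : (l : ℤ) < b) (m : ℕ) :
    ∃ c : ℂ, (m = 0 → c = 0) ∧ E q 0 • lowered q v (l + 1) m =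
      c • lowered q v (l + 1) (m - 1) +
      ((qInt q (l + 1) * qInt q (a + b + 1 - l) * qInt q (b - l) / qInt q (b + m - l) : ℝ) : ℂ) •
        F q 1 • lowered q v l m := by
  have hne : ∀ m : ℕ, qInt q (b + m - l) ≠ 0 := fun m => (qInt_pos hq0 hq1 (by lia)).ne'
  induction m with
  | zero =>
    refine ⟨0, fun _ => rfl, ?_⟩
    have h0 := hne 0
    rw [Nat.cast_zero, add_zero] at h0 ⊢
    rw [E₁_smul_lowered_zero hq0 hq1 h hE, zero_smul, zero_add, mul_div_cancel_right₀ _ h0]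
  | succ m ih =>
    obtain ⟨c, hc, ih⟩ := ih
    -- At `m = 0` the truncated `m - 1` would break this identity; there `c = 0` rescues it.
    have hF : F q 0 • c • lowered q v (l + 1) (m - 1) = c • lowered q v (l + 1) m := by
      rw [smul_comm, F₁_smul_lowered hq0 h]
      cases m with
      | zero => simp [hc rfl]
      | succ m => rfl
    have e : qInt q (l + 1) * qInt q (a + b + 1 - l) * qInt q (b - l) / qInt q (b + m - l) *
        (qInt q (b + m - l) / qInt q (b + m - l + 1)) =
        qInt q (l + 1) * qInt q (a + b + 1 - l) * qInt q (b - l) / qInt q (b + (m + 1 : ℕ) - l) := by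
      rw [show b + ((m + 1 : ℕ) : ℤ) - l = b + m - l + 1 by push_cast; ring]
      field_simp [hne m]
    set d := qInt q (l + 1) * qInt q (a + b + 1 - l) * qInt q (b - l) / qInt q (b + m - l)
    refine ⟨c + d * (qInt q (b + m - l + 1) : ℂ)⁻¹ + qInt q (a - 2 * m - (l + 1 : ℕ)), by simp, ?_⟩
    rw [← F₁_smul_lowered hq0 h,
      E_smul_F_same hq0.ne' (isWeight_lowered hq0.ne' h (l + 1) m).K₁, ih, smul_add, hF,
      smul_smul_comm (F q 0), F₁_F₂_smul_lowered hq0 hq1 h (by lia), ← e, Complex.ofReal_mul,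
      Nat.add_sub_cancel]
    generalize F q 1 • lowered q v l (m + 1) = y
    module

end lowered
end Module

/-! ### Irreducibility in terms of the generators -/

section Simple
variable {q : ℝ} {V : Type*} [AddCommGroup V] [Module ℂ V] [Module (UqSU3 q) V]
  [IsScalarTower ℂ (UqSU3 q) V]

theorem smul_mem_of_generators (S : Submodule ℂ V)
    (hE : ∀ i, ∀ x ∈ S, E q i • x ∈ S) (hF : ∀ i, ∀ x ∈ S, F q i • x ∈ S)
    (hK : ∀ i, ∀ x ∈ S, K q i • x ∈ S) (hKinv : ∀ i, ∀ x ∈ S, Kinv q i • x ∈ S)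
    (X : UqSU3 q) {x : V} (hx : x ∈ S) : X • x ∈ S := by
  obtain ⟨X, rfl⟩ := mk_surjective q X
  induction X using FreeAlgebra.induction generalizing x with
  | grade0 c =>
    rw [AlgHom.commutes, algebraMap_smul]
    exact S.smul_mem c hx
  | grade1 g =>
    cases g with
    | E i => exact hE i x hx
    | F i => exact hF i x hx
    | K i => exact hK i x hx
    | Kinv i => exact hKinv i x hx
  | mul a b ha hb => rw [map_mul, mul_smul]; exact ha (hb hx)
  | add a b ha hb => rw [map_add, add_smul]; exact S.add_mem (ha hx) (hb hx)

/-- A nonzero subspace of a simple module that is stable under the generators is everything. -/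
theorem eq_top_of_generators [IsSimpleModule (UqSU3 q) V] (S : Submodule ℂ V)
    (hE : ∀ i, ∀ x ∈ S, E q i • x ∈ S) (hF : ∀ i, ∀ x ∈ S, F q i • x ∈ S)
    (hK : ∀ i, ∀ x ∈ S, K q i • x ∈ S) (hKinv : ∀ i, ∀ x ∈ S, Kinv q i • x ∈ S)
    {v : V} (hv : v ∈ S) (hv0 : v ≠ 0) : S = ⊤ := by
  let T : Submodule (UqSU3 q) V :=
    { carrier := S
      add_mem' := S.add_mem
      zero_mem' := S.zero_mem
      smul_mem' := fun X _ hx => smul_mem_of_generators S hE hF hK hKinv X hx }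
  rcases eq_bot_or_eq_top T with h | h
  · exact absurd ((Submodule.mem_bot (UqSU3 q)).1 (h ▸ (show v ∈ T from hv))) hv0
  · rw [eq_top_iff]
    exact fun x _ => (h ▸ Submodule.mem_top : x ∈ T)

end Simple

/-! ### Contravariant inner product and `sl₂`-strings -/

section Inner
variable {q : ℝ} {V : Type*} [NormedAddCommGroup V] [InnerProductSpace ℂ V]
  [Module (UqSU3 q) V]

/-- The inner product is contravariant for the `*`-structure. -/
def IsUnitary (q : ℝ) (V : Type*) [NormedAddCommGroup V] [InnerProductSpace ℂ V]
    [Module (UqSU3 q) V] : Prop :=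
  ∀ (X : UqSU3 q) (x y : V), inner ℂ (X • x) y = inner ℂ x (star X • y)

theorem IsUnitary.inner_F_smul (hV : IsUnitary q V) (i : Fin 2) (x y : V) :
    inner ℂ (F q i • x) y = inner ℂ x (E q i • Kinv q i • y) := by
  rw [hV, star_F, mul_smul]

theorem zpow_coe_injective (hq0 : 0 < q) (hq1 : q < 1) :
    Function.Injective fun n : ℤ => (q : ℂ) ^ n := by
  intro a b h
  have h' : ((q ^ a : ℝ) : ℂ) = ((q ^ b : ℝ) : ℂ) := by push_cast; exact h
  exact zpow_right_injective₀ hq0 hq1.ne (Complex.ofReal_injective h')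

/-- Eigenvectors of `K_i` for different eigenvalues are orthogonal. -/
theorem IsUnitary.inner_eq_zero_of_K (hV : IsUnitary q V) (hq0 : 0 < q) (hq1 : q < 1) {i : Fin 2}
    {x y : V} {a b : ℤ} (hx : K q i • x = ((q : ℂ) ^ a) • x) (hy : K q i • y = ((q : ℂ) ^ b) • y)
    (hab : a ≠ b) : inner ℂ x y = 0 := by
  have h := hV (K q i) x y
  rw [star_K, hx, hy, inner_smul_left, inner_smul_right, map_zpow₀, Complex.conj_ofReal] at h
  by_contra h0
  exact hab (zpow_coe_injective hq0 hq1 (mul_right_cancel₀ h0 h))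

variable [IsScalarTower ℂ (UqSU3 q) V]

theorem IsUnitary.inner_F_smul_of_K (hV : IsUnitary q V) (hq : q ≠ 0) {i : Fin 2} (x : V) {y : V}
    {b : ℤ} (hy : K q i • y = ((q : ℂ) ^ b) • y) :
    inner ℂ (F q i • x) y = (q : ℂ) ^ (-b) * inner ℂ x (E q i • y) := by
  rw [hV.inner_F_smul, Kinv_smul_of_K_smul hq hy, smul_smul_comm, inner_smul_right]

/-- One `F` is moved to the right, where `E` lowers the string; the power of `q` is the eigenvalue
of `K⁻¹` on `F^(k'+1) y`. Nothing is needed of `x`. -/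
theorem IsUnitary.inner_F_pow_succ (hV : IsUnitary q V) (hq0 : 0 < q) (hq1 : q < 1) {i : Fin 2}
    (x : V) {y : V} {n : ℤ} (hy : K q i • y = ((q : ℂ) ^ n) • y) (hE : E q i • y = 0) (k k' : ℕ) :
    inner ℂ (F q i ^ (k + 1) • x) (F q i ^ (k' + 1) • y) =
      ((q ^ (2 + 2 * k' - n) * qInt q (k' + 1) * qInt q (n - k') : ℝ) : ℂ)
        * inner ℂ (F q i ^ k • x) (F q i ^ k' • y) := by
  rw [pow_succ' _ k, mul_smul, hV.inner_F_smul_of_K hq0.ne' _ (K_smul_F_pow hq0.ne' i hy (k' + 1)),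
    E_smul_F_pow hq0 hq1 hy hE, inner_smul_right, ← mul_assoc]
  congr 1
  rw [cartan, if_pos rfl, show -(n - ((k' + 1 : ℕ) : ℤ) * 2) = 2 + 2 * k' - n by push_cast; ring]
  push_cast
  ring

/-- Both heights are lowered together until one is zero; the remaining `F` then becomes an `E`
acting on a vector that it kills. -/
theorem IsUnitary.inner_F_pow_of_ne (hV : IsUnitary q V) (hq0 : 0 < q) (hq1 : q < 1) {i : Fin 2}
    {x y : V} {n n' : ℤ} (hx : K q i • x = ((q : ℂ) ^ n) • x)
    (hy : K q i • y = ((q : ℂ) ^ n') • y) (hEx : E q i • x = 0) (hEy : E q i • y = 0)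
    {k k' : ℕ} (h : k ≠ k') : inner ℂ (F q i ^ k • x) (F q i ^ k' • y) = 0 := by
  have base : ∀ {x y : V} {n : ℤ}, K q i • x = ((q : ℂ) ^ n) • x → E q i • x = 0 → ∀ k,
      inner ℂ (F q i ^ (k + 1) • y) x = 0 := by
    intro x y n hx hEx k
    rw [pow_succ', mul_smul, hV.inner_F_smul_of_K hq0.ne' _ hx, hEx, inner_zero_right, mul_zero]
  induction k generalizing k' with
  | zero =>
    obtain ⟨k', rfl⟩ := Nat.exists_eq_succ_of_ne_zero h.symm
    rw [pow_zero, one_smul, inner_eq_zero_symm]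
    exact base hx hEx k'
  | succ k ih =>
    cases k' with
    | zero => rw [pow_zero, one_smul]; exact base hy hEy k
    | succ k' => rw [hV.inner_F_pow_succ hq0 hq1 x hy hEy, ih (by lia), mul_zero]

/-- The `F`-string through a highest weight vector of weight `n` has length at most `n + 1`. -/
theorem IsUnitary.F_pow_smul_eq_zero (hV : IsUnitary q V) (hq0 : 0 < q) (hq1 : q < 1) {i : Fin 2}
    {x : V} {n : ℕ} (hx : K q i • x = ((q : ℂ) ^ (n : ℤ)) • x) (hE : E q i • x = 0)
    {k : ℕ} (hk : n < k) : F q i ^ k • x = 0 := by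
  induction k, hk using Nat.le_induction with
  | base =>
    -- The squared norm of `F^(n+1) x` contains the factor `[n - n] = 0`.
    rw [← inner_self_eq_zero (𝕜 := ℂ), hV.inner_F_pow_succ hq0 hq1 x hx hE, sub_self, qInt_zero]
    simp
  | succ k _ ih => rw [pow_succ', mul_smul, ih, smul_zero]

/-! ### Norms and orthogonality of the basis vectors -/

section lowered
variable {v : V} {l₁ l₂ : ℕ}

theorem IsUnitary.inner_lowered_succ (hV : IsUnitary q V) (hq0 : 0 < q) (hq1 : q < 1)
    (h : IsWeight q v l₁ l₂) (hE : ∀ i, E q i • v = 0) {l : ℕ} (hl : l < l₂) (m : ℕ) :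
    inner ℂ (lowered q v (l + 1) m) (lowered q v (l + 1) m) =
      ((q ^ (3 + 2 * (l : ℤ) + m - l₁ - l₂) * qInt q (l + 1) * qInt q ((l₂ : ℤ) - l)
        * qInt q ((l₂ : ℤ) + 1 + m - l) * qInt q ((l₁ : ℤ) + l₂ + 1 - l) : ℝ) : ℂ) *
        inner ℂ (lowered q v l m) (lowered q v l m) := by
  have hq := hq0.ne'
  have hw := isWeight_lowered hq h
  have hE₂ := E₂_smul_lowered hq h (hE 1)
  obtain ⟨c, -, hc⟩ := E₁_smul_lowered hq0 hq1 h (hE 0) (by exact_mod_cast hl) m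
  -- The image of `F₂` is orthogonal to the kernel of `E₂`. This removes both the `F₂F₁` part of
  -- `F̂₃` and the unspecified `c` term.
  have h1 : ∀ x l' m', inner ℂ (F q 1 • x) (lowered q v l' m') = 0 := fun x l' m' => by
    rw [hV.inner_F_smul_of_K hq x (hw l' m').K₂, hE₂, inner_zero_right, mul_zero]
  have hstep : inner ℂ (F q 1 • lowered q v l m) (F q 1 • lowered q v l m) =
      ((q ^ (2 - ((l₂ : ℤ) + m - l)) * qInt q ((l₂ : ℤ) + m - l) : ℝ) : ℂ)
        * inner ℂ (lowered q v l m) (lowered q v l m) := by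
    have := hV.inner_F_pow_succ hq0 hq1 (lowered q v l m) (hw l m).K₂ (hE₂ l m) 0 0
    simpa [qInt_one hq0 hq1] using this
  have hne : qInt q ((l₂ : ℤ) + m - l) ≠ 0 := (qInt_pos hq0 hq1 (by lia)).ne'
  refine (congrArg (inner ℂ · (lowered q v (l + 1) m)) (lowered_succ_left hq h l m)).trans ?_
  rw [inner_sub_left, inner_smul_left, inner_smul_left, h1, mul_zero, sub_zero,
    hV.inner_F_smul_of_K hq _ (hw (l + 1) m).K₁, hc, inner_add_right, inner_smul_right, h1, mul_zero,
    zero_add, inner_smul_right, hstep, Complex.conj_ofReal]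
  simp only [← mul_assoc]
  congr 1
  simp only [← Complex.ofReal_zpow, ← Complex.ofReal_mul]
  congr 1
  have e : q ^ (3 + 2 * (l : ℤ) + m - l₁ - l₂) =
      q ^ (-((l₁ : ℤ) - 2 * m - (l + 1 : ℕ))) * q ^ (2 - ((l₂ : ℤ) + m - l)) := by
    rw [← zpow_add₀ hq]
    congr 1; push_cast; ring
  rw [e, show (l₂ : ℤ) + 1 + m - l = l₂ + m - l + 1 by ring]
  field_simp

theorem IsUnitary.inner_lowered_self (hV : IsUnitary q V) (hq0 : 0 < q) (hq1 : q < 1)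
    (h : IsWeight q v l₁ l₂) (hE : ∀ i, E q i • v = 0) (hv : inner ℂ v v = 1) {l : ℕ} (hl : l ≤ l₂)
    (m : ℕ) : inner ℂ (lowered q v l m) (lowered q v l m) = (H q l₁ l₂ 0 l m : ℂ) := by
  induction l with
  | zero =>
    simp only [lowered, pow_zero, one_smul]
    induction m with
    | zero => simpa [H_zero] using hv
    | succ m ih =>
      rw [hV.inner_F_pow_succ hq0 hq1 v h.K₁ (hE 0), ih, H_succ_right hq0 hq1, ← Complex.ofReal_mul]
  | succ l ih =>
    rw [hV.inner_lowered_succ hq0 hq1 h hE (by lia), ih (by lia), H_succ_mid hq0 hq1,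
      ← Complex.ofReal_mul]

theorem IsUnitary.inner_basis_self (hV : IsUnitary q V) (hq0 : 0 < q) (hq1 : q < 1)
    (h : IsWeight q v l₁ l₂) (hE : ∀ i, E q i • v = 0) (hv : inner ℂ v v = 1) {l : ℕ} (hl : l ≤ l₂)
    (k m : ℕ) : inner ℂ (F q 1 ^ k • lowered q v l m) (F q 1 ^ k • lowered q v l m) =
      (H q l₁ l₂ k l m : ℂ) := by
  induction k with
  | zero => simpa using hV.inner_lowered_self hq0 hq1 h hE hv hl m
  | succ k ih =>
    rw [hV.inner_F_pow_succ hq0 hq1 _ (isWeight_lowered hq0.ne' h l m).K₂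
      (E₂_smul_lowered hq0.ne' h (hE 1) l m), ih, H_succ_left hq0 hq1,
      show (l₂ : ℤ) + m - l = l₂ - l + m by ring, ← Complex.ofReal_mul]

theorem IsUnitary.inner_basis_of_ne (hV : IsUnitary q V) (hq0 : 0 < q) (hq1 : q < 1)
    (h : IsWeight q v l₁ l₂) (hE : ∀ i, E q i • v = 0) {k l m k' l' m' : ℕ}
    (hne : ¬(k = k' ∧ l = l' ∧ m = m')) :
    inner ℂ (F q 1 ^ k • lowered q v l m) (F q 1 ^ k' • lowered q v l' m') = 0 := by
  have hq := hq0.ne'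
  have hw := isWeight_lowered hq h
  have hE₂ := E₂_smul_lowered hq h (hE 1)
  by_cases hk : k = k'
  · subst hk
    -- At equal `k` the weights determine `2m + l` and `m - l`, hence `(l, m)`; so one of the two
    -- Cartan elements separates the vectors.
    by_cases h1 : (l₁ : ℤ) - 2 * m - l = l₁ - 2 * m' - l'
    · refine hV.inner_eq_zero_of_K hq0 hq1 (K_smul_F_pow hq 1 (hw l m).K₂ k)
        (K_smul_F_pow hq 1 (hw l' m').K₂ k) ?_
      lia
    · refine hV.inner_eq_zero_of_K hq0 hq1 (K_smul_F_pow hq 1 (hw l m).K₁ k)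
        (K_smul_F_pow hq 1 (hw l' m').K₁ k) ?_
      lia
  · exact hV.inner_F_pow_of_ne hq0 hq1 (hw l m).K₂ (hw l' m').K₂ (hE₂ l m) (hE₂ l' m') hk

/-! ### Vanishing outside the index range and spanning -/

theorem lowered_eq_zero_of_left (hV : IsUnitary q V) (hq0 : 0 < q) (hq1 : q < 1)
    (h : IsWeight q v l₁ l₂) (hE : ∀ i, E q i • v = 0) {l : ℕ} (hl : l₂ < l) (m : ℕ) :
    lowered q v l m = 0 := by
  have hq := hq0.ne'
  induction l, hl using Nat.le_induction with
  | succ l _ ih => rw [← hatF3_smul_lowered, ih, smul_zero]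
  | base =>
    induction m with
    | succ m ih => rw [← F₁_smul_lowered hq0 h, ih, smul_zero]
    | zero =>
      -- At `l = λ₂`, `m = 0` the `K₂`-weight is zero, so `F₂` kills the vector, and the coefficient
      -- of `F₂F₁` in `F̂₃` is `[0] = 0`.
      have hw := (isWeight_lowered hq h l₂ 0).K₂
      have h0 : F q 1 ^ 1 • lowered q v l₂ 0 = 0 :=
        hV.F_pow_smul_eq_zero (n := 0) hq0 hq1 (by simpa using hw)
          (E₂_smul_lowered hq h (hE 1) l₂ 0) one_pos
      rw [pow_one] at h0
      rw [lowered_succ_left hq h, h0]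
      simp [qInt_zero]

theorem lowered_eq_zero_of_right (hV : IsUnitary q V) (hq0 : 0 < q) (hq1 : q < 1)
    (h : IsWeight q v l₁ l₂) (hE : ∀ i, E q i • v = 0) (l : ℕ) {m : ℕ} (hm : l₁ < m) :
    lowered q v l m = 0 := by
  rw [lowered, hV.F_pow_smul_eq_zero hq0 hq1 h.K₁ (hE 0) hm, smul_zero]

/-- The span of the vectors `F₂^k F̂₃^l F₁^m v` over the index set of the basis. -/
noncomputable def basisSpan (q : ℝ) {V : Type*} [AddCommGroup V] [Module ℂ V] [Module (UqSU3 q) V]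
    (v : V) (l₁ l₂ : ℕ) : Submodule ℂ V :=
  Submodule.span ℂ (Set.range fun p : basisIndex l₁ l₂ =>
    F q 1 ^ p.1.1 • lowered q v p.1.2.1 p.1.2.2)

theorem mem_basisSpan (hV : IsUnitary q V) (hq0 : 0 < q) (hq1 : q < 1)
    (h : IsWeight q v l₁ l₂) (hE : ∀ i, E q i • v = 0) (k l m : ℕ) :
    F q 1 ^ k • lowered q v l m ∈ basisSpan q v l₁ l₂ := by
  by_cases hm : l₁ < m
  · simp [lowered_eq_zero_of_right hV hq0 hq1 h hE l hm]
  by_cases hl : l₂ < l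
  · simp [lowered_eq_zero_of_left hV hq0 hq1 h hE hl m]
  by_cases hk : l₂ + m < k + l
  · have hw := (isWeight_lowered hq0.ne' h l m).K₂
    rw [show (l₂ : ℤ) + m - l = ((l₂ + m - l : ℕ) : ℤ) by lia] at hw
    simp [hV.F_pow_smul_eq_zero hq0 hq1 hw (E₂_smul_lowered hq0.ne' h (hE 1) l m)
      (show l₂ + m - l < k by lia)]
  · exact Submodule.subset_span
      ⟨⟨(k, l, m), not_lt.1 hm, not_lt.1 hl, not_lt.1 hk⟩, rfl⟩

theorem smul_mem_basisSpan {X : UqSU3 q}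
    (hX : ∀ k l m, l ≤ l₂ → X • F q 1 ^ k • lowered q v l m ∈ basisSpan q v l₁ l₂)
    {x : V} (hx : x ∈ basisSpan q v l₁ l₂) : X • x ∈ basisSpan q v l₁ l₂ := by
  induction hx using Submodule.span_induction with
  | mem x hx => obtain ⟨p, rfl⟩ := hx; exact hX _ _ _ p.2.2.1
  | zero => simp
  | add x y _ _ hx hy => rw [smul_add]; exact add_mem hx hy
  | smul c x _ hx => rw [smul_smul_comm]; exact Submodule.smul_mem _ c hx

/-- The cases `k = 0, 1` are explicit; beyond them the Serre relation expresses `F₁F₂²` through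
`F₂F₁F₂` and `F₂²F₁`, and the span is stable under `F₂`. The bound `l ≤ λ₂` permits the division in
the case `k = 1`. -/
theorem F₁_smul_mem_basisSpan (hV : IsUnitary q V) (hq0 : 0 < q) (hq1 : q < 1)
    (h : IsWeight q v l₁ l₂) (hE : ∀ i, E q i • v = 0) (k m : ℕ) {l : ℕ} (hl : l ≤ l₂) :
    F q 0 • F q 1 ^ k • lowered q v l m ∈ basisSpan q v l₁ l₂ := by
  have hmem := mem_basisSpan hV hq0 hq1 h hE
  have hF : ∀ {x}, x ∈ basisSpan q v l₁ l₂ → F q 1 • x ∈ basisSpan q v l₁ l₂ :=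
    smul_mem_basisSpan fun k l m _ => by
      rw [← mul_smul, ← pow_succ']; exact hmem _ _ _
  induction k using Nat.twoStepInduction with
  | zero =>
    have := hmem 0 l (m + 1)
    rwa [pow_zero, one_smul, F₁_smul_lowered hq0 h, ← one_smul (UqSU3 q) (lowered q v l (m + 1)),
      ← pow_zero (F q 1)]
  | one =>
    have h1 := hmem 0 (l + 1) m
    have h2 := hmem 1 l (m + 1)
    rw [pow_zero, one_smul] at h1
    rw [pow_one] at h2 ⊢
    rw [F₁_F₂_smul_lowered hq0 hq1 h (by lia)]
    exact add_mem (Submodule.smul_mem _ _ h1) (Submodule.smul_mem _ _ h2)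
  | more k ih1 ih2 =>
    have hs := serre_F_smul (q := q) (i := 1) (j := 0) (by decide) (F q 1 ^ k • lowered q v l m)
    rw [eq_sub_iff_add_eq', ← eq_sub_iff_add_eq] at hs
    rw [pow_succ', pow_succ', mul_smul, mul_smul, hs]
    rw [pow_succ', mul_smul] at ih2
    exact sub_mem (Submodule.smul_mem _ _ (hF ih2)) (hF (hF ih1))

/-- `E₁` commutes with `F₂`, so it suffices to know it on `u l m`, where it yields vectors of the
same family. -/
theorem E₁_smul_mem_basisSpan (hV : IsUnitary q V) (hq0 : 0 < q) (hq1 : q < 1)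
    (h : IsWeight q v l₁ l₂) (hE : ∀ i, E q i • v = 0) (k m : ℕ) {l : ℕ} (hl : l ≤ l₂) :
    E q 0 • F q 1 ^ k • lowered q v l m ∈ basisSpan q v l₁ l₂ := by
  have hmem := mem_basisSpan hV hq0 hq1 h hE
  have hcomm : E q 0 • F q 1 ^ k • lowered q v l m = F q 1 ^ k • E q 0 • lowered q v l m := by
    induction k with
    | zero => simp
    | succ k ih => rw [pow_succ', mul_smul, E_smul_F_ne (by decide), ih, mul_smul]
  rw [hcomm]
  cases l with
  | zero =>
    cases m with
    | zero => simp [lowered, hE]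
    | succ m =>
      rw [lowered, pow_zero, one_smul, E_smul_F_pow hq0 hq1 h.K₁ (hE 0) m, smul_smul_comm]
      have := hmem k 0 m
      rw [lowered, pow_zero, one_smul] at this
      exact Submodule.smul_mem _ _ this
  | succ l =>
    obtain ⟨c, -, hc⟩ := E₁_smul_lowered hq0 hq1 h (hE 0) (by exact_mod_cast hl) m
    rw [hc, smul_add, smul_smul_comm, smul_smul_comm, ← mul_smul (F q 1 ^ k), ← pow_succ]
    exact add_mem (Submodule.smul_mem _ _ (hmem _ _ _)) (Submodule.smul_mem _ _ (hmem _ _ _))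

theorem basisSpan_eq_top [IsSimpleModule (UqSU3 q) V] (hV : IsUnitary q V) (hq0 : 0 < q)
    (hq1 : q < 1) (h : IsWeight q v l₁ l₂) (hE : ∀ i, E q i • v = 0) (hv : v ≠ 0) :
    basisSpan q v l₁ l₂ = ⊤ := by
  have hq := hq0.ne'
  have hmem := mem_basisSpan hV hq0 hq1 h hE
  have hK : ∀ i k l m, ∃ a : ℤ,
      K q i • F q 1 ^ k • lowered q v l m = ((q : ℂ) ^ a) • F q 1 ^ k • lowered q v l m := by
    intro i k l m
    fin_cases i
    · exact ⟨_, K_smul_F_pow hq 1 (isWeight_lowered hq h l m).K₁ k⟩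
    · exact ⟨_, K_smul_F_pow hq 1 (isWeight_lowered hq h l m).K₂ k⟩
  have hv' : v ∈ basisSpan q v l₁ l₂ := by simpa [lowered] using hmem 0 0 0
  refine eq_top_of_generators _ (fun i x => smul_mem_basisSpan fun k l m hl => ?_)
    (fun i x => smul_mem_basisSpan fun k l m hl => ?_)
    (fun i x => smul_mem_basisSpan fun k l m hl => ?_)
    (fun i x => smul_mem_basisSpan fun k l m hl => ?_) hv' hv
  · fin_cases i
    · exact E₁_smul_mem_basisSpan hV hq0 hq1 h hE k m hl
    · cases k with
      | zero => simp [E₂_smul_lowered hq h (hE 1)]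
      | succ k =>
        change E q 1 • _ ∈ _
        rw [E_smul_F_pow hq0 hq1 (isWeight_lowered hq h l m).K₂ (E₂_smul_lowered hq h (hE 1) l m)]
        exact Submodule.smul_mem _ _ (hmem _ _ _)
  · fin_cases i
    · exact F₁_smul_mem_basisSpan hV hq0 hq1 h hE k m hl
    · change F q 1 • _ ∈ _
      rw [← mul_smul, ← pow_succ']
      exact hmem _ _ _
  · obtain ⟨a, ha⟩ := hK i k l m
    rw [ha]
    exact Submodule.smul_mem _ _ (hmem _ _ _)
  · obtain ⟨a, ha⟩ := hK i k l m
    rw [Kinv_smul_of_K_smul hq ha]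
    exact Submodule.smul_mem _ _ (hmem _ _ _)

end lowered
end Inner
end UqSU3

/-! ### The orthogonal basis -/

theorem theorem2p3 (q : ℝ) (hq0 : 0 < q) (hq1 : q < 1) (l₁ l₂ : ℕ)
    {V : Type*} [NormedAddCommGroup V] [InnerProductSpace ℂ V] [FiniteDimensional ℂ V]
    [Module (UqSU3 q) V] [IsScalarTower ℂ (UqSU3 q) V] [IsSimpleModule (UqSU3 q) V]
    (v : V) (hE : ∀ i, UqSU3.E q i • v = 0)
    (hK₁ : UqSU3.K q 0 • v = ((q : ℂ) ^ l₁) • v) (hK₂ : UqSU3.K q 1 • v = ((q : ℂ) ^ l₂) • v)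
    (hv : inner ℂ v v = 1)
    (hstar : ∀ (X : UqSU3 q) (x y : V), inner ℂ (X • x) y = inner ℂ x (star X • y)) :
    (∃ b : Module.Basis (UqSU3.basisIndex l₁ l₂) ℂ V, ∀ p : UqSU3.basisIndex l₁ l₂,
      b p = (UqSU3.F q 1 ^ p.1.1 * UqSU3.hatF3 q ^ p.1.2.1 * UqSU3.F q 0 ^ p.1.2.2) • v) ∧
    (∀ k l m k' l' m' : ℕ, (k, l, m) ∈ UqSU3.basisIndex l₁ l₂ →
      (k', l', m') ∈ UqSU3.basisIndex l₁ l₂ →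
      inner ℂ ((UqSU3.F q 1 ^ k * UqSU3.hatF3 q ^ l * UqSU3.F q 0 ^ m) • v)
          ((UqSU3.F q 1 ^ k' * UqSU3.hatF3 q ^ l' * UqSU3.F q 0 ^ m') • v) =
        if k = k' ∧ l = l' ∧ m = m' then (UqSU3.H q l₁ l₂ k l m : ℂ) else 0) ∧
    (∀ k l m : ℕ, (k, l, m) ∈ UqSU3.basisIndex l₁ l₂ → 0 < UqSU3.H q l₁ l₂ k l m) := by
  have hV : UqSU3.IsUnitary q V := hstar
  have h : UqSU3.IsWeight q v l₁ l₂ := ⟨by simpa using hK₁, by simpa using hK₂⟩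
  have hv0 : v ≠ 0 := by
    rintro rfl
    simp at hv
  have hvec : ∀ k l m : ℕ, (UqSU3.F q 1 ^ k * UqSU3.hatF3 q ^ l * UqSU3.F q 0 ^ m) • v =
      UqSU3.F q 1 ^ k • UqSU3.lowered q v l m := fun k l m => by
    rw [mul_smul, mul_smul, UqSU3.lowered]
  simp only [hvec]
  refine ⟨?_, ?_, fun k l m => UqSU3.H_pos hq0 hq1⟩
  · have hli : LinearIndependent ℂ fun p : UqSU3.basisIndex l₁ l₂ =>
        UqSU3.F q 1 ^ p.1.1 • UqSU3.lowered q v p.1.2.1 p.1.2.2 := by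
      refine linearIndependent_of_ne_zero_of_inner_eq_zero (fun p => ?_) fun p p' hp => ?_
      · rw [← inner_self_ne_zero (𝕜 := ℂ), hV.inner_basis_self hq0 hq1 h hE hv p.2.2.1]
        exact_mod_cast (UqSU3.H_pos hq0 hq1 p.2).ne'
      · exact hV.inner_basis_of_ne hq0 hq1 h hE fun ⟨h1, h2, h3⟩ =>
          hp (Subtype.ext (Prod.ext h1 (Prod.ext h2 h3)))
    have htop := UqSU3.basisSpan_eq_top hV hq0 hq1 h hE hv0
    exact ⟨Module.Basis.mk hli htop.ge, fun p => Module.Basis.mk_apply hli htop.ge p⟩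
  · intro k l m k' l' m' hp _
    split_ifs with hh
    · obtain ⟨rfl, rfl, rfl⟩ := hh
      exact hV.inner_basis_self hq0 hq1 h hE hv hp.2.1 k m
    · exact hV.inner_basis_of_ne hq0 hq1 h hE hh
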